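/- **The pseudo-monad $T$.** For a category $A$, let $TA$ be the category whose objects are triples $(X,\mu,(M_x)_{x\in X})$ with $X$ a set, $\mu$ an ultrafilter on $X$ and $M_x$ objects of $A$. A morphism $(X,\mu,(M_x))\to(Y,\nu,(N_y))$ is represented by a function $f:Y'\to X$ with $Y'\in\nu$ and $f_*(\nu|_{Y'})=\mu$, together with morphisms $\sigma_y:M_{f(y)}\to N_y$ $(y\in Y')$; two representatives are identified if they agree on a member of $\nu$. $T$ acts on functors and natural transformations entrywise. The unit sends $M$ to the one-point family $M$; the multiplication sends $(S,\mu,(T_s,\nu_s,(M_{s,t})_{t\in T_s})_{s\in S})$ to $(\coprod_s T_s,\int_S\nu_s\,d\mu,(M_{s,t}))$, where $W\in\int_S\nu_s\,d\mu$ iff $\{s:\{t:(s,t)\in W\}\in\nu_s\}\in\mu$. A *colax $T$-algebra* on $A$ consists of a functor $m:TA\to A$ and natural transformations $i: m\circ\eta\Rightarrow \mathrm{id}$ (unitor) and $a: m\circ\mu_A\Rightarrow m\circ Tm$ (associator) satisfying the two unit axioms and the associativity axiom of a colax algebra, with the canonical bijections $\coprod_{*}X\cong X\cong\coprod_{x\in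 X}*$ and $\coprod_r\coprod_s T_{r,s}\cong\coprod_{(r,s)}T_{r,s}$ inserted. It is a *pseudo-algebra* if $i$ and $a$ are invertible. **Metric ultraproducts.** For an ultrafilter $\mu$ on $X$ and metric spaces $(M_x)_{x\in X}$ with distances bounded by a common constant, $\int_X M_x\,d\mu$ is the set of sections $(q_x)$ defined on a member of $\mu$, where $q$ and $r$ are identified if for every $\varepsilon>0$ the set of $x$ with $d(q_x,r_x)<\varepsilon$ belongs to $\mu$; the distance of two classes is $\lim_\mu d(q_x,r_x)$. (If all $M_x$ are nonempty this is the usual quotient of $\prod_x M_x$.) A colax $T$-algebra on a category of metric spaces or of metric structures is called an *ultraproduct algebra* if, up to identification of the underlying sets, $m(X,\mu,(M_x))$ is the metric ultraproduct (for structures: the metric ultraproduct in each sort, with function symbols interpreted entrywise and relation symbols by the limits of their values along $\mu$), $m(f,\sigma)$ sends $(q_x)_x$ to $(\sigma_y(q_{f(y)}))_y$, $i$ sends a one-point family to its entry, and $a$ is the comparison map $$\int_{\coprod_S T_s}M_{s,t}\,d\Big(\int_S\nu_s\,d\mu\Big)\longrightarrow\int_S\int_{T_s}M_{s,t}\,d\nu_s\,d\mu,\qquad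 (q_{s,t})\mapsto((q_{s,t})).$$ **Theorem.** 1. Let $L$ be a many-sorted language of continuous first-order logic (every sort $s$ has a bound $k_s>0$ for its metric, every relation symbol a compact interval of values, every function and relation symbol a modulus of uniform continuity), and let $\Theta$ be a set of $L$-sentences. Let $\mathrm{Mod}(\Theta)$ be the category whose objects are the metric structures (complete metric spaces, possibly empty, with interpretations of the symbols) in which every sentence of $\Theta$ has the value $0$, and whose morphisms are the elementary maps. (Over an empty sort, $\sup$ and $\inf$ take the lower, respectively upper, end of the range of the formula.) Then $\mathrm{Mod}(\Theta)$ has an ultraproduct algebra structure, and every such structure is a pseudo-algebra for $T$: its unitor and its associator are invertible. 2. Let $k$ be a real number. The category of complete metric spaces (possibly empty) with distances at most $k$ and maps that do not increase distances has an ultraproduct algebra structure, and every such structure is a pseudo-algebra for $T$; every component of its associator is a bijection. -/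

import Mathlib

open CategoryTheory Filter Topology

universe u v w w₁ w₂ w₃ w₄ w₅ w₆

/-! ### Partial sections defined on a set of an ultrafilter -/

/-- A section of the family `E` that is defined on a member of the ultrafilter `μ`. -/
structure PSec {X : Type u} (μ : Ultrafilter X) (E : X → Type w) where
  dom : Set X
  dom_mem : dom ∈ μ
  val : ∀ x, x ∈ dom → E x

namespace PSec

variable {X : Type u} {μ : Ultrafilter X} {E : X → Type w}

/-- Two partial sections have the same germ: they agree on a member of `μ`. -/
def Agree (p q : PSec μ E) : Prop :=
  {x | ∃ (h : x ∈ p.dom) (h' : x ∈ q.dom), p.val x h = q.val x h'} ∈ μ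

theorem Agree.refl (p : PSec μ E) : p.Agree p :=
  mem_of_superset p.dom_mem fun _ h => ⟨h, h, rfl⟩

theorem Agree.symm {p q : PSec μ E} (h : p.Agree q) : q.Agree p :=
  mem_of_superset h fun _ ⟨h₁, h₂, e⟩ => ⟨h₂, h₁, e.symm⟩

theorem Agree.trans {p q r : PSec μ E} (h : p.Agree q) (h' : q.Agree r) : p.Agree r :=
  mem_of_superset (inter_mem h h') fun _ ⟨⟨h₁, _, e⟩, ⟨_, h₃, e'⟩⟩ => ⟨h₁, h₃, e.trans e'⟩

/-- Apply a family of functions pointwise. -/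
def map {F : X → Type w₁} (g : ∀ x, E x → F x) (p : PSec μ E) : PSec μ F where
  dom := p.dom
  dom_mem := p.dom_mem
  val x h := g x (p.val x h)

/-- A finite family of partial sections as one partial section of tuples. -/
def tuple {n : ℕ} {F : Fin n → X → Type w} (p : ∀ j, PSec μ (F j)) :
    PSec μ (fun x => ∀ j, F j x) where
  dom := {x | ∀ j, x ∈ (p j).dom}
  dom_mem := (eventually_all (l := (μ : Filter X))).2 fun j => (p j).dom_mem
  val x h := fun j => (p j).val x (h j)

/-- The distance of two partial sections of metric spaces, computed pointwise. -/
def pdist [∀ x, MetricSpace (E x)] (p q : PSec μ E) : PSec μ (fun _ => ℝ) where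
  dom := p.dom ∩ q.dom
  dom_mem := inter_mem p.dom_mem q.dom_mem
  val x h := dist (p.val x h.1) (q.val x h.2)

/-- The real number `r` is the limit along `μ` of the partial real-valued function `p`. -/
def HasLim (p : PSec μ (fun _ => ℝ)) (r : ℝ) : Prop :=
  ∀ ε > 0, {x | ∃ h : x ∈ p.dom, |p.val x h - r| < ε} ∈ μ

end PSec

/-! ### The ultraproduct of metric spaces -/

/-- Two partial sections are identified when, for every `ε > 0`, they are `ε`-close on a member
of the ultrafilter. -/
def infClose {X : Type u} (μ : Ultrafilter X) (E : X → Type w) [∀ x, MetricSpace (E x)] :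
    Setoid (PSec μ E) where
  r p q := ∀ ε > 0,
    {x | ∃ (h : x ∈ p.dom) (h' : x ∈ q.dom), dist (p.val x h) (q.val x h') < ε} ∈ μ
  iseqv :=
    { refl := fun p ε hε => mem_of_superset p.dom_mem fun x h => ⟨h, h, by simpa using hε⟩
      symm := fun h ε hε => mem_of_superset (h ε hε) fun x ⟨h₁, h₂, e⟩ =>
        ⟨h₂, h₁, by rwa [dist_comm]⟩
      trans := fun h h' ε hε =>
        mem_of_superset (inter_mem (h (ε / 2) (half_pos hε)) (h' (ε / 2) (half_pos hε)))
          fun x ⟨⟨h₁, _, e⟩, ⟨_, h₃, e'⟩⟩ =>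
            ⟨h₁, h₃, (dist_triangle _ _ _).trans_lt (by linarith)⟩ }

/-- The underlying set of the metric ultraproduct: sections defined almost everywhere, modulo
being infinitesimally close. If all spaces are nonempty, every class contains a total section, so
that this is the usual quotient of the product; if some spaces are empty, the ultraproduct is
empty exactly when almost all of them are. -/
def Ultraprod {X : Type u} (μ : Ultrafilter X) (E : X → Type w) [∀ x, MetricSpace (E x)] :
    Type (max u w) :=
  Quotient (infClose μ E)

/-- The point of the ultraproduct given by a partial section. -/
def Ultraprod.mk {X : Type u} {μ : Ultrafilter X} {E : X → Type w} [∀ x, MetricSpace (E x)]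
    (p : PSec μ E) : Ultraprod μ E :=
  Quotient.mk (infClose μ E) p

/-! ### The category of formal ultraproducts of objects of `A` -/

/-- A family of objects of `A` indexed by a set that carries an ultrafilter. -/
structure Ult (A : Type w₁) where
  idx : Type u
  uf : Ultrafilter idx
  obj : idx → A

namespace Ult

variable {A : Type w₁} [Category.{w₂} A] {B : Type w₃} [Category.{w₄} B]

/-- Representatives of morphisms `x ⟶ y`: a function `f` from a large subset of `y.idx` to `x.idx`
that carries `y.uf` to `x.uf`, and morphisms `x.obj (f j) ⟶ y.obj j`. The pair of `f j` and the
morphism over `j` is `sec.val j _`. -/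
structure HomRep (x y : Ult.{u} A) where
  sec : PSec y.uf (fun j => Σ i : x.idx, (x.obj i ⟶ y.obj j))
  push : ∀ s : Set x.idx, s ∈ x.uf ↔ {j | ∃ h : j ∈ sec.dom, (sec.val j h).1 ∈ s} ∈ y.uf

/-- Representatives are equivalent when both components agree on a large set. -/
def homSetoid (x y : Ult.{u} A) : Setoid (HomRep x y) where
  r φ ψ := φ.sec.Agree ψ.sec
  iseqv := ⟨fun φ => PSec.Agree.refl φ.sec, PSec.Agree.symm, PSec.Agree.trans⟩

/-- Morphisms of formal ultraproducts. -/
def Hom (x y : Ult.{u} A) : Type (max u w₂) := Quotient (homSetoid x y)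

/-- The morphism with a given representative. -/
def Hom.mk {x y : Ult.{u} A} (φ : HomRep x y) : Hom x y := Quotient.mk (homSetoid x y) φ

theorem Hom.mk_eq {x y : Ult.{u} A} {φ ψ : HomRep x y} :
    Hom.mk φ = Hom.mk ψ ↔ φ.sec.Agree ψ.sec :=
  ⟨fun h => Quotient.exact h, fun h => Quotient.sound h⟩

/-- A representative given by an everywhere defined function. -/
def HomRep.ofFun {x y : Ult.{u} A} (f : y.idx → x.idx)
    (hf : y.uf.map f = x.uf) (σ : ∀ j, x.obj (f j) ⟶ y.obj j) : HomRep x y where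
  sec := ⟨Set.univ, univ_mem, fun j _ => ⟨f j, σ j⟩⟩
  push s := by
    rw [← hf, Ultrafilter.mem_map]
    simp [Set.preimage]

/-- Composition of representatives. -/
def HomRep.comp {x y z : Ult.{u} A} (φ : HomRep x y) (ψ : HomRep y z) : HomRep x z where
  sec :=
    { dom := {k | ∃ h : k ∈ ψ.sec.dom, (ψ.sec.val k h).1 ∈ φ.sec.dom}
      dom_mem := (ψ.push _).1 φ.sec.dom_mem
      val := fun k hk =>
        ⟨(φ.sec.val (ψ.sec.val k hk.1).1 hk.2).1,
          (φ.sec.val (ψ.sec.val k hk.1).1 hk.2).2 ≫ (ψ.sec.val k hk.1).2⟩ }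
  push s := by
    rw [φ.push s, ψ.push]
    refine iff_of_eq (congrArg (· ∈ z.uf) ?_)
    ext k
    constructor
    · rintro ⟨h, h', e⟩
      exact ⟨⟨h, h'⟩, e⟩
    · rintro ⟨⟨h, h'⟩, e⟩
      exact ⟨h, h', e⟩

theorem HomRep.comp_agree {x y z : Ult.{u} A} {φ φ' : HomRep x y} {ψ ψ' : HomRep y z}
    (h : φ.sec.Agree φ'.sec) (h' : ψ.sec.Agree ψ'.sec) :
    (φ.comp ψ).sec.Agree (φ'.comp ψ').sec := by
  refine mem_of_superset (inter_mem h' ((ψ.push _).1 h)) ?_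
  rintro k ⟨⟨h₁, h₂, e⟩, ⟨_, h₃, h₄, e'⟩⟩
  have key : ∀ (p p' : Σ j, (y.obj j ⟶ z.obj k)) (_ : p = p') (a : p.1 ∈ φ.sec.dom)
      (a' : p.1 ∈ φ'.sec.dom), φ.sec.val p.1 a = φ'.sec.val p.1 a' →
      ∃ a'' : p'.1 ∈ φ'.sec.dom,
        (⟨(φ.sec.val p.1 a).1, (φ.sec.val p.1 a).2 ≫ p.2⟩ : Σ i, (x.obj i ⟶ z.obj k)) =
          ⟨(φ'.sec.val p'.1 a'').1, (φ'.sec.val p'.1 a'').2 ≫ p'.2⟩ := by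
    rintro p _ rfl a a' e
    exact ⟨a', by rw [e]⟩
  obtain ⟨a'', e''⟩ := key _ _ e h₃ h₄ e'
  exact ⟨⟨h₁, h₃⟩, ⟨h₂, a''⟩, e''⟩

instance : Category (Ult.{u} A) where
  Hom := Hom
  id x := Hom.mk (HomRep.ofFun id (Ultrafilter.map_id _) fun j => 𝟙 (x.obj j))
  comp f g := Quotient.map₂ HomRep.comp
    (fun _ _ h _ _ h' => HomRep.comp_agree h h') f g
  id_comp {x y} f := by
    induction f using Quotient.inductionOn with | _ φ
    refine Quotient.sound (mem_of_superset φ.sec.dom_mem fun j h => ⟨⟨h, trivial⟩, h, ?_⟩)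
    simp [HomRep.comp, HomRep.ofFun]
  comp_id {x y} f := by
    induction f using Quotient.inductionOn with | _ φ
    refine Quotient.sound (mem_of_superset φ.sec.dom_mem fun j h => ⟨⟨trivial, h⟩, h, ?_⟩)
    simp [HomRep.comp, HomRep.ofFun]
  assoc {x y z t} f g k := by
    induction f using Quotient.inductionOn with | _ φ
    induction g using Quotient.inductionOn with | _ ψ
    induction k using Quotient.inductionOn with | _ χ
    refine Quotient.sound (mem_of_superset (HomRep.comp (HomRep.comp φ ψ) χ).sec.dom_mem ?_)
    rintro j ⟨h₁, h₂, h₃⟩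
    refine ⟨⟨h₁, h₂, h₃⟩, ⟨⟨h₁, h₂⟩, h₃⟩, ?_⟩
    simp [HomRep.comp]

/-- The morphism with a given representative. -/
def homMk {x y : Ult.{u} A} (φ : HomRep x y) : x ⟶ y := Hom.mk φ

theorem homMk_eq {x y : Ult.{u} A} {φ ψ : HomRep x y} :
    homMk φ = homMk ψ ↔ φ.sec.Agree ψ.sec := Hom.mk_eq

theorem homMk_surj {x y : Ult.{u} A} (f : x ⟶ y) : ∃ φ, homMk φ = f := Quotient.exists_rep f

theorem homMk_comp {x y z : Ult.{u} A} (φ : HomRep x y) (ψ : HomRep y z) :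
    homMk φ ≫ homMk ψ = homMk (φ.comp ψ) := rfl

theorem id_eq (x : Ult.{u} A) :
    𝟙 x = homMk (HomRep.ofFun id (Ultrafilter.map_id _) fun j => 𝟙 (x.obj j)) := rfl

/-- The morphism given by an everywhere defined function. -/
def ofFun {x y : Ult.{u} A} (f : y.idx → x.idx) (hf : y.uf.map f = x.uf)
    (σ : ∀ j, x.obj (f j) ⟶ y.obj j) : x ⟶ y :=
  homMk (HomRep.ofFun f hf σ)

/-- A chosen representative. -/
noncomputable def rep {x y : Ult.{u} A} (f : x ⟶ y) : HomRep x y := (homMk_surj f).choose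

theorem homMk_rep {x y : Ult.{u} A} (f : x ⟶ y) : homMk (rep f) = f := (homMk_surj f).choose_spec

/-! ### The action on functors and natural transformations -/

/-- The action of a functor on representatives. -/
def HomRep.mapRep (F : A ⥤ B) {x y : Ult.{u} A} (φ : HomRep x y) :
    HomRep (⟨x.idx, x.uf, fun i => F.obj (x.obj i)⟩ : Ult.{u} B)
      (⟨y.idx, y.uf, fun j => F.obj (y.obj j)⟩ : Ult.{u} B) where
  sec := ⟨φ.sec.dom, φ.sec.dom_mem, fun j h => ⟨(φ.sec.val j h).1, F.map (φ.sec.val j h).2⟩⟩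
  push := φ.push

/-- The functor on formal ultraproducts induced by a functor. -/
def map (F : A ⥤ B) : Ult.{u} A ⥤ Ult.{u} B where
  obj x := ⟨x.idx, x.uf, fun i => F.obj (x.obj i)⟩
  map {x y} f := Quotient.map (HomRep.mapRep F)
    (fun φ ψ (h : φ.sec.Agree ψ.sec) =>
      mem_of_superset h fun j ⟨h₁, h₂, e⟩ => ⟨h₁, h₂, congrArg
        (fun p : Σ i : x.idx, (x.obj i ⟶ y.obj j) =>
          (⟨p.1, F.map p.2⟩ : Σ i : x.idx, (F.obj (x.obj i) ⟶ F.obj (y.obj j)))) e⟩) f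
  map_id x := by
    refine Quotient.sound (mem_of_superset univ_mem fun j h => ⟨trivial, trivial, ?_⟩)
    simp [HomRep.mapRep, HomRep.ofFun]
  map_comp {x y z} f g := by
    induction f using Quotient.inductionOn with | _ φ
    induction g using Quotient.inductionOn with | _ ψ
    refine Quotient.sound (mem_of_superset (HomRep.comp φ ψ).sec.dom_mem ?_)
    rintro j h
    refine ⟨h, h, ?_⟩
    simp [HomRep.mapRep, HomRep.comp]

/-- The natural transformation of induced functors given by a natural transformation. -/
def mapNat {F G : A ⥤ B} (ω : F ⟶ G) : map.{u} F ⟶ map.{u} G where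
  app x := ofFun (x := (map F).obj x) (y := (map G).obj x) id (Ultrafilter.map_id _)
    fun j => ω.app (x.obj j)
  naturality {x y} f := by
    induction f using Quotient.inductionOn with | _ φ
    refine Quotient.sound (mem_of_superset φ.sec.dom_mem fun j h =>
      ⟨⟨trivial, h⟩, ⟨h, trivial⟩, ?_⟩)
    simp [HomRep.mapRep, HomRep.comp, HomRep.ofFun, map]

/-! ### Unit and multiplication -/

/-- The unit: an object as a family indexed by a point. -/
def unit : A ⥤ Ult.{u} A where
  obj c := ⟨PUnit.{u + 1}, pure PUnit.unit, fun _ => c⟩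
  map {c c'} g := ofFun (x := ⟨PUnit.{u + 1}, pure PUnit.unit, fun _ => c⟩)
    (y := ⟨PUnit.{u + 1}, pure PUnit.unit, fun _ => c'⟩) id (Ultrafilter.map_id _) fun _ => g
  map_id _ := rfl
  map_comp _ _ := homMk_eq.2
    (mem_of_superset univ_mem fun _ _ => ⟨trivial, ⟨trivial, trivial⟩, rfl⟩)

/-- The ultrafilter on a disjoint union assembled from ultrafilters `ν s` on the summands along an
ultrafilter `μ`: a set is large when, for `μ`-almost all `s`, its part in the summand `s` is
`ν s`-large. -/
def sigmaUf {S : Type u} (μ : Ultrafilter S) {T : S → Type u} (ν : ∀ s, Ultrafilter (T s)) :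
    Ultrafilter (Σ s, T s) :=
  μ.bind fun s => (ν s).map (Sigma.mk s)

theorem mem_sigmaUf {S : Type u} {μ : Ultrafilter S} {T : S → Type u}
    {ν : ∀ s, Ultrafilter (T s)} {W : Set (Σ s, T s)} :
    W ∈ sigmaUf μ ν ↔ {s | {t | (⟨s, t⟩ : Σ s, T s) ∈ W} ∈ ν s} ∈ μ := Iff.rfl

/-- The multiplication on objects: a family of families as one family indexed by the disjoint
union of the index sets. -/
def multObj (x : Ult.{u} (Ult.{u} A)) : Ult.{u} A where
  idx := Σ s, (x.obj s).idx
  uf := sigmaUf x.uf fun s => (x.obj s).uf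
  obj p := (x.obj p.1).obj p.2

/-- The multiplication on representatives. -/
noncomputable def HomRep.multRep {x y : Ult.{u} (Ult.{u} A)} (φ : HomRep x y) :
    HomRep (multObj x) (multObj y) where
  sec :=
    { dom := {p | ∃ h : p.1 ∈ φ.sec.dom, p.2 ∈ (rep (φ.sec.val p.1 h).2).sec.dom}
      dom_mem := mem_sigmaUf.2 (mem_of_superset φ.sec.dom_mem fun s h =>
        mem_of_superset (rep (φ.sec.val s h).2).sec.dom_mem fun t h' => ⟨h, h'⟩)
      val := fun p hp =>
        ⟨⟨(φ.sec.val p.1 hp.1).1, ((rep (φ.sec.val p.1 hp.1).2).sec.val p.2 hp.2).1⟩,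
          ((rep (φ.sec.val p.1 hp.1).2).sec.val p.2 hp.2).2⟩ }
  push W := by
    refine mem_sigmaUf.trans ((φ.push _).trans (Iff.trans ?_ mem_sigmaUf.symm))
    refine ⟨fun H => mem_of_superset H ?_, fun H => mem_of_superset (inter_mem H φ.sec.dom_mem) ?_⟩
    · rintro s ⟨h, h'⟩
      refine mem_of_superset (((rep (φ.sec.val s h).2).push _).1 h') ?_
      rintro t ⟨k, k'⟩
      exact ⟨⟨h, k⟩, k'⟩
    · rintro s ⟨h', h⟩
      refine ⟨h, ((rep (φ.sec.val s h).2).push _).2 (mem_of_superset h' ?_)⟩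
      rintro t ⟨⟨_, k⟩, k'⟩
      exact ⟨k, k'⟩

/-- The multiplication. -/
noncomputable def mult : Ult.{u} (Ult.{u} A) ⥤ Ult.{u} A where
  obj := multObj
  map {x y} f := Quotient.map HomRep.multRep
    (fun φ ψ (h : φ.sec.Agree ψ.sec) => by
      refine mem_sigmaUf.2 (mem_of_superset h ?_)
      rintro s ⟨h₁, h₂, e⟩
      refine mem_of_superset (rep (φ.sec.val s h₁).2).sec.dom_mem fun t ht => ?_
      have key : ∀ (p p' : Σ i, (x.obj i ⟶ y.obj s)) (_ : p = p')
          (a : t ∈ (rep p.2).sec.dom), ∃ a' : t ∈ (rep p'.2).sec.dom,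
          (⟨⟨p.1, ((rep p.2).sec.val t a).1⟩, ((rep p.2).sec.val t a).2⟩ :
            Σ i : (multObj x).idx, ((multObj x).obj i ⟶ (multObj y).obj ⟨s, t⟩)) =
          ⟨⟨p'.1, ((rep p'.2).sec.val t a').1⟩, ((rep p'.2).sec.val t a').2⟩ := by
        rintro p _ rfl a
        exact ⟨a, rfl⟩
      obtain ⟨a', e'⟩ := key _ _ e ht
      exact ⟨⟨h₁, ht⟩, ⟨h₂, a'⟩, e'⟩) f
  map_id x := by
    refine homMk_eq.2 (mem_sigmaUf.2 (mem_of_superset univ_mem fun s _ => ?_))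
    have h := homMk_eq.1 ((homMk_rep (𝟙 (x.obj s))).trans (id_eq _))
    refine mem_of_superset h ?_
    rintro t ⟨h₁, h₂, e⟩
    exact ⟨⟨trivial, h₁⟩, trivial, congrArg (fun p : Σ i : (x.obj s).idx,
      ((x.obj s).obj i ⟶ (x.obj s).obj t) => (⟨⟨s, p.1⟩, p.2⟩ : Σ i : (multObj x).idx,
        ((multObj x).obj i ⟶ (multObj x).obj ⟨s, t⟩))) e⟩
  map_comp {x y z} f g := by
    induction f using Quotient.inductionOn with | _ φ
    induction g using Quotient.inductionOn with | _ ψ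
    refine homMk_eq.2 (mem_sigmaUf.2 (mem_of_superset (φ.comp ψ).sec.dom_mem ?_))
    rintro s ⟨h₁, h₂⟩
    let a := (φ.sec.val (ψ.sec.val s h₁).1 h₂).2
    let b := (ψ.sec.val s h₁).2
    have h : (rep (a ≫ b)).sec.Agree ((rep a).comp (rep b)).sec :=
      homMk_eq.1 ((homMk_rep (a ≫ b)).trans
        (((congrArg₂ (· ≫ ·) (homMk_rep a) (homMk_rep b)).symm).trans (homMk_comp _ _)))
    refine mem_of_superset h ?_
    rintro t ⟨k₁, ⟨k₂, k₃⟩, e⟩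
    exact ⟨⟨⟨h₁, h₂⟩, k₁⟩, ⟨⟨h₁, k₂⟩, h₂, k₃⟩, congrArg (fun p : Σ i : (x.obj _).idx,
      ((x.obj _).obj i ⟶ (z.obj s).obj t) =>
        (⟨⟨(φ.sec.val (ψ.sec.val s h₁).1 h₂).1, p.1⟩, p.2⟩ : Σ i : (multObj x).idx,
        ((multObj x).obj i ⟶ (multObj z).obj ⟨s, t⟩))) e⟩

/-! ### Coherence isomorphisms of the pseudo-monad

The disjoint unions `Σ r, Σ s, T r s` and `Σ (p : Σ r, S r), T p.1 p.2`, respectively `I`,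
`Σ _ : PUnit, I` and `Σ _ : I, PUnit`, are only canonically isomorphic. -/

/-- The canonical isomorphism from the multiplication of `map mult` to that of `mult`. -/
noncomputable def assocHom (x : Ult.{u} (Ult.{u} (Ult.{u} A))) :
    mult.obj ((map mult).obj x) ⟶ mult.obj (mult.obj x) :=
  ofFun (x := mult.obj ((map mult).obj x)) (y := mult.obj (mult.obj x))
    (fun p => ⟨p.1.1, p.1.2, p.2⟩) (by ext W; rfl) fun _ => 𝟙 _

/-- The canonical isomorphism to the disjoint union of a single index set. -/
noncomputable def unitHomLeft (x : Ult.{u} A) : x ⟶ mult.obj (unit.obj x) :=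
  ofFun (x := x) (y := mult.obj (unit.obj x)) (fun p => p.2) (by ext W; rfl) fun _ => 𝟙 _

/-- The canonical isomorphism to the disjoint union of points. -/
noncomputable def unitHomRight (x : Ult.{u} A) : x ⟶ mult.obj ((map unit).obj x) :=
  ofFun (x := x) (y := mult.obj ((map unit).obj x)) (fun p => p.1) (by ext W; rfl) fun _ => 𝟙 _

end Ult

/-! ### Colax algebras and pseudo-algebras -/

/-- A colax algebra for the pseudo-monad `Ult`: an action `m`, a unitor `i` and an associator `a`,
not necessarily invertible. The canonical isomorphisms of disjoint unions stand for the identities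
that occur in the axioms of a colax algebra for a strict 2-monad. -/
structure ColaxAlgebra (A : Type w₁) [Category.{w₂} A] where
  /-- the action -/
  m : Ult.{u} A ⥤ A
  /-- the unitor -/
  i : Ult.unit.{u} ⋙ m ⟶ 𝟭 A
  /-- the associator -/
  a : Ult.mult.{u} ⋙ m ⟶ Ult.map.{u} m ⋙ m
  left_unit : ∀ x : Ult.{u} A,
    m.map (Ult.unitHomLeft x) ≫ a.app (Ult.unit.obj x) ≫ i.app (m.obj x) = 𝟙 (m.obj x)
  right_unit : ∀ x : Ult.{u} A,
    m.map (Ult.unitHomRight x) ≫ a.app ((Ult.map Ult.unit).obj x) ≫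
      m.map ((Ult.mapNat i).app x) = 𝟙 (m.obj x)
  assoc : ∀ x : Ult.{u} (Ult.{u} (Ult.{u} A)),
    a.app ((Ult.map Ult.mult).obj x) ≫ m.map ((Ult.mapNat a).app x) =
      m.map (Ult.assocHom x) ≫ a.app (Ult.mult.obj x) ≫ a.app ((Ult.map (Ult.map m)).obj x)

/-- A colax algebra is normal if its unitor is invertible. -/
def ColaxAlgebra.IsNormal {A : Type w₁} [Category.{w₂} A] (P : ColaxAlgebra.{u} A) : Prop :=
  IsIso P.i

/-- A pseudo-algebra is a normal colax algebra whose associator is invertible. -/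
def ColaxAlgebra.IsPseudoAlgebra {A : Type w₁} [Category.{w₂} A] (P : ColaxAlgebra.{u} A) : Prop :=
  P.IsNormal ∧ IsIso P.a

/-! ### Complete metric spaces of bounded distance -/

/-- A complete metric space, possibly empty, with distances at most `k`. -/
structure CompMet (k : ℝ) where
  carrier : Type u
  [metric : MetricSpace carrier]
  [complete : CompleteSpace carrier]
  bounded : ∀ a b : carrier, dist a b ≤ k

attribute [instance] CompMet.metric CompMet.complete

/-- Morphisms are the maps that do not increase distances. -/
instance CompMet.category (k : ℝ) : Category (CompMet.{u} k) where
  Hom X Y := {f : X.carrier → Y.carrier // ∀ a b, dist (f a) (f b) ≤ dist a b}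
  id X := ⟨id, fun _ _ => le_rfl⟩
  comp f g := ⟨g.1 ∘ f.1, fun a b => (g.2 _ _).trans (f.2 a b)⟩

/-- The function underlying a morphism. -/
def CompMet.fn {k : ℝ} {X Y : CompMet.{u} k} (f : X ⟶ Y) : X.carrier → Y.carrier := f.1

/-! ### Continuous first-order logic -/

/-- A many-sorted language of continuous logic. Every sort has a bound for its metric, every
relation symbol a compact interval of values, and every function or relation symbol a modulus of
uniform continuity. -/
structure ContLanguage where
  Srt : Type v
  bound : Srt → ℝ
  bound_pos : ∀ s, 0 < bound s
  Fn : Type v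
  fnArity : Fn → ℕ
  fnDom : ∀ f, Fin (fnArity f) → Srt
  fnCod : Fn → Srt
  fnMod : Fn → ℝ → ℝ
  fnMod_pos : ∀ f, ∀ ε > 0, 0 < fnMod f ε
  Rel : Type v
  relArity : Rel → ℕ
  relDom : ∀ R, Fin (relArity R) → Srt
  lo : Rel → ℝ
  hi : Rel → ℝ
  lo_le_hi : ∀ R, lo R ≤ hi R
  relMod : Rel → ℝ → ℝ
  relMod_pos : ∀ R, ∀ ε > 0, 0 < relMod R ε

namespace ContLanguage

variable (L : ContLanguage.{v})

/-- A metric structure: complete bounded metric spaces with interpretations of the symbols that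
respect the prescribed moduli and intervals. -/
structure Str where
  sort : ∀ s : L.Srt, CompMet.{u} (L.bound s)
  fn : ∀ f : L.Fn, (∀ j, (sort (L.fnDom f j)).carrier) → (sort (L.fnCod f)).carrier
  fn_unif : ∀ f, ∀ ε > 0, ∀ a b : ∀ j, (sort (L.fnDom f j)).carrier,
    (∀ j, dist (a j) (b j) < L.fnMod f ε) → dist (fn f a) (fn f b) ≤ ε
  rel : ∀ R : L.Rel, (∀ j, (sort (L.relDom R j)).carrier) → ℝ
  rel_mem : ∀ R a, rel R a ∈ Set.Icc (L.lo R) (L.hi R)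
  rel_unif : ∀ R, ∀ ε > 0, ∀ a b : ∀ j, (sort (L.relDom R j)).carrier,
    (∀ j, dist (a j) (b j) < L.relMod R ε) → |rel R a - rel R b| ≤ ε

/-- The variables of sort `s` in a context, which is the list of the sorts of its variables. -/
inductive Var : List L.Srt → L.Srt → Type v
  | zero {Γ : List L.Srt} {s : L.Srt} : Var (s :: Γ) s
  | succ {Γ : List L.Srt} {s t : L.Srt} : Var Γ s → Var (t :: Γ) s

/-- Terms in a context. -/
inductive Term (Γ : List L.Srt) : L.Srt → Type v
  | var {s : L.Srt} : L.Var Γ s → Term Γ s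
  | app (f : L.Fn) : (∀ j, Term Γ (L.fnDom f j)) → Term Γ (L.fnCod f)

/-- Formulas in a context: the metrics and the relation symbols applied to terms, continuous
functions as connectives, and suprema and infima as quantifiers. -/
inductive Formula : List L.Srt → Type v
  | dist {Γ : List L.Srt} {s : L.Srt} : L.Term Γ s → L.Term Γ s → Formula Γ
  | rel {Γ : List L.Srt} (R : L.Rel) : (∀ j, L.Term Γ (L.relDom R j)) → Formula Γ
  | conn {Γ : List L.Srt} {n : ℕ} : C(Fin n → ℝ, ℝ) → (Fin n → Formula Γ) → Formula Γ
  | sup {Γ : List L.Srt} (s : L.Srt) : Formula (s :: Γ) → Formula Γ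
  | inf {Γ : List L.Srt} (s : L.Srt) : Formula (s :: Γ) → Formula Γ

variable {L}

/-- The lower and the upper end of the compact interval in which the values of a formula lie. -/
noncomputable def Formula.range : {Γ : List L.Srt} → L.Formula Γ → ℝ × ℝ
  | _, .dist (s := s) _ _ => (0, L.bound s)
  | _, .rel R _ => (L.lo R, L.hi R)
  | _, .conn u φ =>
    (sInf (u '' Set.Icc (fun j => (φ j).range.1) (fun j => (φ j).range.2)),
      sSup (u '' Set.Icc (fun j => (φ j).range.1) (fun j => (φ j).range.2)))
  | _, .sup _ φ => φ.range
  | _, .inf _ φ => φ.range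

/-- Assignments of elements of a structure to the variables of a context. -/
def Env (M : Str.{u} L) (Γ : List L.Srt) : Type (max u v) :=
  ∀ s, L.Var Γ s → (M.sort s).carrier

/-- The assignment for the empty context. -/
def Env.nil (M : Str.{u} L) : Env M [] := fun _ x => nomatch x

/-- The extension of an assignment by a value of one more variable. -/
def Env.cons {M : Str.{u} L} {Γ : List L.Srt} {t : L.Srt} (a : (M.sort t).carrier)
    (e : Env M Γ) : Env M (t :: Γ)
  | _, .zero => a
  | _, .succ x => e _ x

/-- The value of a term. -/
def Term.val {M : Str.{u} L} {Γ : List L.Srt} (e : Env M Γ) :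
    {s : L.Srt} → L.Term Γ s → (M.sort s).carrier
  | _, .var x => e _ x
  | _, .app f t => M.fn f fun j => (t j).val e

/-- The value of a formula. Adding the lower end of the range to the set whose supremum is formed
changes nothing if the sort is nonempty; over an empty sort, the supremum is that lower end.
Likewise for infima and upper ends. -/
noncomputable def Formula.val {M : Str.{u} L} : {Γ : List L.Srt} → L.Formula Γ → Env M Γ → ℝ
  | _, .dist t₁ t₂, e => Dist.dist (t₁.val e) (t₂.val e)
  | _, .rel R t, e => M.rel R fun j => (t j).val e
  | _, .conn u φ, e => u fun j => (φ j).val e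
  | _, .sup s φ, e =>
    sSup (insert φ.range.1 (Set.range fun a : (M.sort s).carrier => φ.val (e.cons a)))
  | _, .inf s φ, e =>
    sInf (insert φ.range.2 (Set.range fun a : (M.sort s).carrier => φ.val (e.cons a)))

variable (L) in
/-- Sentences are formulas without free variables. -/
abbrev Sentence := L.Formula []

/-- The models of a theory `Th`: the structures in which all sentences of `Th` have the
value `0`. -/
structure Model (Th : Set L.Sentence) where
  str : Str.{u} L
  sat : ∀ φ ∈ Th, φ.val (Env.nil str) = 0

variable {Th : Set L.Sentence}

/-- Elementary maps: families of functions that preserve the values of all formulas. -/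
structure ElemMap (M N : Model.{u} Th) where
  toFun : ∀ s, (M.str.sort s).carrier → (N.str.sort s).carrier
  elem : ∀ {Γ : List L.Srt} (φ : L.Formula Γ) (e : Env M.str Γ),
    φ.val (M := N.str) (fun s x => toFun s (e s x)) = φ.val e

/-- The category of models of a theory and elementary maps. -/
instance Model.category : Category (Model.{u} Th) where
  Hom := ElemMap
  id M := ⟨fun _ a => a, fun _ _ => rfl⟩
  comp f g := ⟨fun s a => g.toFun s (f.toFun s a), fun φ e =>
    (g.elem φ fun s x => f.toFun s (e s x)).trans (f.elem φ e)⟩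

theorem ElemMap.dist_eq {M N : Model.{u} Th} (f : ElemMap M N) (s : L.Srt)
    (a b : (M.str.sort s).carrier) : dist (f.toFun s a) (f.toFun s b) = dist a b :=
  f.elem (.dist (Γ := [s, s]) (.var .zero) (.var (.succ .zero)))
    (Env.cons a (Env.cons b (Env.nil M.str)))

/-- The functor that sends a model to one of its sorts. -/
def Model.sortFunctor (Th : Set L.Sentence) (s : L.Srt) :
    Model.{u} Th ⥤ CompMet.{u} (L.bound s) where
  obj M := M.str.sort s
  map {M N} f := ⟨ElemMap.toFun f s, fun a b => (ElemMap.dist_eq f s a b).le⟩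

end ContLanguage

/-! ### Algebra structures given by ultraproducts -/

/-- A partial section over a disjoint union as a partial section of partial sections. -/
def PSec.curry {A : Type w₁} [Category.{w₂} A] {x : Ult.{u} (Ult.{u} A)} {E : A → Type w}
    (q : PSec (Ult.mult.obj x).uf fun p => E ((Ult.mult.obj x).obj p)) :
    PSec x.uf fun s => PSec (x.obj s).uf fun t => E ((x.obj s).obj t) where
  dom := {s | {t | (⟨s, t⟩ : Σ s, (x.obj s).idx) ∈ q.dom} ∈ (x.obj s).uf}
  dom_mem := Ult.mem_sigmaUf.1 q.dom_mem
  val s h := ⟨{t | (⟨s, t⟩ : Σ s, (x.obj s).idx) ∈ q.dom}, h, fun t h' => q.val ⟨s, t⟩ h'⟩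

/-- A morphism of formal ultraproducts that is represented by `f` and `σ` sends the partial
section `p` to the partial section `j ↦ σ j (p (f j))`. -/
def PSec.push {A : Type w₁} [Category.{w₂} A] {k : ℝ} (F : A ⥤ CompMet.{w} k) {x y : Ult.{u} A}
    (φ : Ult.HomRep x y) (p : PSec x.uf fun i => (F.obj (x.obj i)).carrier) :
    PSec y.uf fun j => (F.obj (y.obj j)).carrier where
  dom := {j | ∃ h : j ∈ φ.sec.dom, (φ.sec.val j h).1 ∈ p.dom}
  dom_mem := (φ.push _).1 p.dom_mem
  val j h := CompMet.fn (F.map (φ.sec.val j h.1).2) (p.val _ h.2)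

/-- The data that exhibit the action of a colax algebra, after the functor `F` to metric spaces,
as the metric ultraproduct, with the standard unitor and the standard comparison of the ultraproduct
over a disjoint union with the iterated ultraproduct. -/
structure ColaxAlgebra.UltraproductData {A : Type w₁} [Category.{w₂} A] (P : ColaxAlgebra.{u} A)
    {k : ℝ} (F : A ⥤ CompMet.{w} k) where
  /-- the points of `F (m x)` are the points of the ultraproduct of the `F (x.obj i)` -/
  pt : ∀ x : Ult.{u} A,
    Ultraprod x.uf (fun i => (F.obj (x.obj i)).carrier) ≃ (F.obj (P.m.obj x)).carrier
  /-- the distance is the limit of the distances -/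
  dist_lim : ∀ (x : Ult.{u} A) (p q : PSec x.uf fun i => (F.obj (x.obj i)).carrier),
    (p.pdist q).HasLim (dist (pt x (Ultraprod.mk p)) (pt x (Ultraprod.mk q)))
  /-- the action on morphisms -/
  map_pt : ∀ {x y : Ult.{u} A} (φ : Ult.HomRep x y)
    (p : PSec x.uf fun i => (F.obj (x.obj i)).carrier),
    CompMet.fn (F.map (P.m.map (Ult.homMk φ))) (pt x (Ultraprod.mk p)) =
      pt y (Ultraprod.mk (p.push F φ))
  /-- the unitor sends a one-point family to its only entry -/
  unit_pt : ∀ (c : A) (p : PSec (Ult.unit.{u}.obj c).uf fun _ => (F.obj c).carrier)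
    (h : PUnit.unit ∈ p.dom),
    CompMet.fn (F.map (P.i.app c)) (pt (Ult.unit.obj c) (Ultraprod.mk p)) = p.val PUnit.unit h
  /-- the associator sends the class of `(q s t)` to the class of the classes `((q s t))` -/
  assoc_pt : ∀ (x : Ult.{u} (Ult.{u} A))
    (q : PSec (Ult.mult.obj x).uf fun p => (F.obj ((Ult.mult.obj x).obj p)).carrier),
    CompMet.fn (F.map (P.a.app x)) (pt (Ult.mult.obj x) (Ultraprod.mk q)) =
      pt ((Ult.map P.m).obj x) (Ultraprod.mk
        ((PSec.curry (E := fun c => (F.obj c).carrier) q).map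
          fun s r => pt (x.obj s) (Ultraprod.mk r)))

/-- The action of a colax algebra on bounded complete metric spaces is the metric ultraproduct. -/
def CompMet.IsUltraproductAlgebra {k : ℝ} (P : ColaxAlgebra.{u} (CompMet.{u} k)) : Prop :=
  Nonempty (P.UltraproductData (𝟭 (CompMet.{u} k)))

/-- The action of a colax algebra on models is the ultraproduct of metric structures: every sort is
the metric ultraproduct, function symbols are interpreted pointwise and relation symbols by the
limits of their values. -/
def ContLanguage.Model.IsUltraproductAlgebra {L : ContLanguage.{v}} {Th : Set L.Sentence}
    (P : ColaxAlgebra.{u} (Model.{u} Th)) : Prop :=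
  ∃ D : ∀ s : L.Srt, P.UltraproductData (Model.sortFunctor.{u} Th s),
    (∀ (x : Ult.{u} (Model.{u} Th)) (f : L.Fn)
      (p : ∀ j, PSec x.uf fun i => ((x.obj i).str.sort (L.fnDom f j)).carrier),
      (P.m.obj x).str.fn f (fun j => (D (L.fnDom f j)).pt x (Ultraprod.mk (p j))) =
        (D (L.fnCod f)).pt x (Ultraprod.mk
          ((PSec.tuple p).map fun i v => (x.obj i).str.fn f v))) ∧
    ∀ (x : Ult.{u} (Model.{u} Th)) (R : L.Rel)
      (p : ∀ j, PSec x.uf fun i => ((x.obj i).str.sort (L.relDom R j)).carrier),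
      ((PSec.tuple p).map fun i v => (x.obj i).str.rel R v).HasLim
        ((P.m.obj x).str.rel R fun j => (D (L.relDom R j)).pt x (Ultraprod.mk (p j)))

/-!
An ultraproduct algebra `P` on a category `A` with a functor `F` to bounded complete metric spaces
has all points of `F (m x)` of the form `pt (mk p)`, for a partial section `p`. On such points the
action, the unitor and the associator are given by explicit formulas. This has two consequences,
which are proved for any such `F` and then applied to the identity functor of complete metric spaces
and to the functors that send a model to one of its sorts.

* The unitor and the associator are bijective isometries. For the distances, a limit along the
  ultrafilter of a disjoint union is an iterated limit (`PSec.HasLim.curry`). For the surjectivity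
  of the associator, representatives of almost all classes `r s` are chosen and form one section over
  the disjoint union (`ActionData.comparison_bijective`). A bijective isometry is invertible among
  metric spaces, and an elementary map that is bijective in every sort is invertible among models.
  So every ultraproduct algebra is a pseudo-algebra.

* Naturality and the axioms of a colax algebra hold automatically, as both sides of each equation
  send the class of `p` to classes of sections that agree almost everywhere. They follow from the
  formulas for the action, the unitor and the associator alone (`ActionData`). For the existence of
  the algebra, it therefore suffices to see that the ultraproduct is an object of the category and
  that the maps in question are morphisms.

For metric spaces, the point is that metric ultraproducts of complete spaces are complete
(`Ultraprod.completeSpace`). The ultrafilter may be closed under countable intersections, for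
example principal, so that the completeness of the factors is needed.
For models, the additional input is Łoś's theorem for continuous logic
(`ContLanguage.Formula.hasLim_val`): the value of a formula in the ultraproduct is the limit of its
values in the factors. Hence the ultraproduct is a model, and the action on
morphisms, the unitor and the associator are elementary, since the two values that have to be
compared are limits of the same values.
-/

/-! ### Limits of partial real-valued functions along an ultrafilter -/

namespace PSec

variable {X : Type u} {μ : Ultrafilter X}

/-- The extension by `0` of a partial real-valued function. -/
noncomputable def total (p : PSec μ (fun _ => ℝ)) (x : X) : ℝ :=
  open Classical in if h : x ∈ p.dom then p.val x h else 0

theorem total_of_mem (p : PSec μ (fun _ => ℝ)) {x : X} (h : x ∈ p.dom) :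
    p.total x = p.val x h := dif_pos h

theorem hasLim_iff_tendsto {p : PSec μ (fun _ => ℝ)} {r : ℝ} :
    p.HasLim r ↔ Tendsto p.total μ (𝓝 r) := by
  rw [Metric.tendsto_nhds]
  refine forall₂_congr fun ε _ => ⟨fun H => ?_, fun H => ?_⟩
  · exact mem_of_superset H fun x ⟨h, e⟩ => by
      simpa [total_of_mem p h, Real.dist_eq] using e
  · exact mem_of_superset (inter_mem H p.dom_mem) fun x ⟨e, h⟩ =>
      ⟨h, by simpa [total_of_mem p h, Real.dist_eq] using e⟩

theorem HasLim.unique {p : PSec μ (fun _ => ℝ)} {r r' : ℝ} (h : p.HasLim r)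
    (h' : p.HasLim r') : r = r' :=
  tendsto_nhds_unique (hasLim_iff_tendsto.1 h) (hasLim_iff_tendsto.1 h')

theorem HasLim.congr {p q : PSec μ (fun _ => ℝ)} {r : ℝ} (h : p.HasLim r) (e : p.Agree q) :
    q.HasLim r := fun ε hε =>
  mem_of_superset (inter_mem (h ε hε) e) fun _ ⟨⟨_, l⟩, ⟨_, h₂, e⟩⟩ => ⟨h₂, by rwa [← e]⟩

theorem exists_hasLim (p : PSec μ (fun _ => ℝ)) {a b : ℝ}
    (h : ∀ x hx, p.val x hx ∈ Set.Icc a b) : ∃ r, p.HasLim r := by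
  have H : Set.Icc a b ∈ μ.map p.total := Ultrafilter.mem_map.2
    (mem_of_superset p.dom_mem fun x hx => by
      simpa [total_of_mem p hx] using h x hx)
  obtain ⟨r, _, hr⟩ := isCompact_Icc.ultrafilter_le_nhds (μ.map p.total) (le_principal_iff.2 H)
  exact ⟨r, hasLim_iff_tendsto.2 hr⟩

theorem HasLim.le_const {p : PSec μ (fun _ => ℝ)} {r c : ℝ} (h : p.HasLim r)
    (H : {x | ∃ hx : x ∈ p.dom, p.val x hx ≤ c} ∈ μ) : r ≤ c :=
  le_of_tendsto (hasLim_iff_tendsto.1 h)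
    (mem_of_superset H fun x ⟨hx, l⟩ => by
      simpa only [Set.mem_ofPred_eq, total_of_mem p hx] using l)

theorem HasLim.const_le {p : PSec μ (fun _ => ℝ)} {r c : ℝ} (h : p.HasLim r)
    (H : {x | ∃ hx : x ∈ p.dom, c ≤ p.val x hx} ∈ μ) : c ≤ r :=
  ge_of_tendsto (hasLim_iff_tendsto.1 h)
    (mem_of_superset H fun x ⟨hx, l⟩ => by
      simpa only [Set.mem_ofPred_eq, total_of_mem p hx] using l)

theorem HasLim.mem_of_lt {p : PSec μ (fun _ => ℝ)} {r c : ℝ} (h : p.HasLim r) (hc : r < c) :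
    {x | ∃ hx : x ∈ p.dom, p.val x hx < c} ∈ μ :=
  mem_of_superset (h (c - r) (sub_pos.2 hc)) fun x ⟨hx, l⟩ =>
    ⟨hx, by linarith [(abs_lt.1 l).2]⟩

theorem HasLim.mem_of_gt {p : PSec μ (fun _ => ℝ)} {r c : ℝ} (h : p.HasLim r) (hc : c < r) :
    {x | ∃ hx : x ∈ p.dom, c < p.val x hx} ∈ μ :=
  mem_of_superset (h (r - c) (sub_pos.2 hc)) fun x ⟨hx, l⟩ =>
    ⟨hx, by linarith [(abs_lt.1 l).1]⟩

theorem HasLim.neg {p : PSec μ (fun _ => ℝ)} {r : ℝ} (h : p.HasLim r) :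
    (p.map fun _ t => -t).HasLim (-r) := fun ε hε =>
  mem_of_superset (h ε hε) fun x ⟨hx, l⟩ => ⟨hx, by
    rw [abs_sub_comm] at l
    simpa [PSec.map, sub_eq_add_neg, add_comm] using l⟩

/-- A continuous function of finitely many partial functions commutes with limits. -/
theorem HasLim.continuous_comp {n : ℕ} (g : C(Fin n → ℝ, ℝ)) {p : Fin n → PSec μ (fun _ => ℝ)}
    {r : Fin n → ℝ} (h : ∀ j, (p j).HasLim (r j)) :
    ((tuple p).map fun _ t => g t).HasLim (g r) := by
  have H : Tendsto (fun x => g fun j => (p j).total x) μ (𝓝 (g r)) :=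
    (g.continuous.tendsto r).comp (tendsto_pi_nhds.2 fun j => hasLim_iff_tendsto.1 (h j))
  refine hasLim_iff_tendsto.2 (H.congr' (mem_of_superset (tuple p).dom_mem fun x hx => ?_))
  have e : (fun j => (p j).total x) = (tuple p).val x hx :=
    funext fun j => total_of_mem (p j) (hx j)
  simp only [Set.mem_ofPred_eq, e]
  exact (total_of_mem ((tuple p).map fun _ t => g t) (x := x) hx).symm

/-- The limit of a partial function over a disjoint union is the limit of the limits over the
summands. -/
theorem HasLim.curry {A : Type w₁} [Category.{w₂} A] {x : Ult.{u} (Ult.{u} A)}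
    {p : PSec (Ult.mult.obj x).uf (fun _ => ℝ)} {r : ℝ} (hp : p.HasLim r)
    {g : PSec x.uf (fun _ => ℝ)}
    (hg : ∀ s (h : s ∈ g.dom) (h' : s ∈ (PSec.curry (E := fun _ : A => ℝ) p).dom),
      ((PSec.curry (E := fun _ : A => ℝ) p).val s h').HasLim (g.val s h)) :
    g.HasLim r := by
  intro ε hε
  refine mem_of_superset (inter_mem (Ult.mem_sigmaUf.1 (hp (ε / 2) (half_pos hε)))
    (inter_mem g.dom_mem (PSec.curry (E := fun _ : A => ℝ) p).dom_mem)) ?_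
  rintro s ⟨hs, h, h'⟩
  refine ⟨h, lt_of_le_of_lt (abs_le.2 ⟨?_, ?_⟩) (half_lt_self hε)⟩
  · have := (hg s h h').const_le (c := r - ε / 2) (mem_of_superset hs fun t ⟨ht, l⟩ =>
      ⟨ht, by
        have := (abs_lt.1 l).1
        change _ ≤ p.val ⟨s, t⟩ ht
        linarith⟩)
    linarith
  · have := (hg s h h').le_const (c := r + ε / 2) (mem_of_superset hs fun t ⟨ht, l⟩ =>
      ⟨ht, by
        have := (abs_lt.1 l).2
        change p.val ⟨s, t⟩ ht ≤ _
        linarith⟩)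
    linarith

end PSec

/-! ### The metric ultraproduct is a complete metric space -/

namespace Ultraprod

section

variable {X : Type u} {μ : Ultrafilter X} {E : X → Type w} [∀ x, MetricSpace (E x)]

theorem mk_eq {p q : PSec μ E} : (mk p : Ultraprod μ E) = mk q ↔ infClose μ E p q :=
  ⟨fun h => Quotient.exact h, fun h => Quotient.sound h⟩

theorem mk_surj (a : Ultraprod μ E) : ∃ p, mk p = a := Quotient.exists_rep a

theorem mk_out (a : Ultraprod μ E) : mk (Quotient.out a) = a := Quotient.out_eq a

theorem mk_eq_of_agree {p q : PSec μ E} (h : p.Agree q) : (mk p : Ultraprod μ E) = mk q :=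
  mk_eq.2 fun _ hε => mem_of_superset h fun _ ⟨h₁, h₂, e⟩ =>
    ⟨h₁, h₂, by rw [e]; simpa using hε⟩

theorem mk_eq_iff_hasLim {p q : PSec μ E} :
    (mk p : Ultraprod μ E) = mk q ↔ (p.pdist q).HasLim 0 := by
  refine mk_eq.trans (forall₂_congr fun ε _ => iff_of_eq (congrArg (· ∈ μ) ?_))
  ext x
  constructor
  · rintro ⟨h, h', l⟩
    exact ⟨⟨h, h'⟩, by simpa [PSec.pdist, abs_of_nonneg dist_nonneg] using l⟩
  · rintro ⟨⟨h, h'⟩, l⟩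
    exact ⟨h, h', by simpa [PSec.pdist, abs_of_nonneg dist_nonneg] using l⟩

theorem hasLim_pdist_congr {p p' q q' : PSec μ E} (hp : (mk p : Ultraprod μ E) = mk p')
    (hq : (mk q : Ultraprod μ E) = mk q') {r : ℝ} (h : (p.pdist q).HasLim r) :
    (p'.pdist q').HasLim r := by
  intro ε hε
  refine mem_of_superset (inter_mem (h (ε / 3) (by positivity))
    (inter_mem (mk_eq.1 hp (ε / 3) (by positivity)) (mk_eq.1 hq (ε / 3) (by positivity)))) ?_
  rintro x ⟨⟨⟨h₁, h₂⟩, l⟩, ⟨_, h₃, l'⟩, ⟨_, h₄, l''⟩⟩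
  refine ⟨⟨h₃, h₄⟩, ?_⟩
  have := dist_dist_dist_le (p'.val x h₃) (q'.val x h₄) (p.val x h₁) (q.val x h₂)
  rw [dist_comm (p'.val x h₃) (p.val x h₁), dist_comm (q'.val x h₄) (q.val x h₂),
    Real.dist_eq] at this
  have l₁ := abs_sub_le (dist (p'.val x h₃) (q'.val x h₄)) (dist (p.val x h₁) (q.val x h₂)) r
  have l₂ : |dist (p.val x h₁) (q.val x h₂) - r| < ε / 3 := l
  change |dist (p'.val x h₃) (q'.val x h₄) - r| < ε
  linarith

end

variable {k : ℝ} {X : Type u} {μ : Ultrafilter X} {E : X → CompMet.{w} k}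

theorem exists_hasLim_pdist (p q : PSec μ fun x => (E x).carrier) :
    ∃ r, (p.pdist q).HasLim r :=
  PSec.exists_hasLim _ (a := 0) (b := k) fun x _ => ⟨dist_nonneg, (E x).bounded _ _⟩

/-- The limit of the distances of two points of the metric ultraproduct. -/
noncomputable def limDist (a b : Ultraprod μ fun x => (E x).carrier) : ℝ :=
  (exists_hasLim_pdist (Quotient.out a) (Quotient.out b)).choose

theorem hasLim_limDist (p q : PSec μ fun x => (E x).carrier) :
    (p.pdist q).HasLim (limDist (mk p) (mk q)) :=
  hasLim_pdist_congr (mk_out (mk p)) (mk_out (mk q))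
    (exists_hasLim_pdist (Quotient.out (mk p)) (Quotient.out (mk q))).choose_spec

/-- The metric of the ultraproduct, the limit of the distances of representatives. -/
@[reducible]
noncomputable def metricSpace (μ : Ultrafilter X) (E : X → CompMet.{w} k) :
    MetricSpace (Ultraprod μ fun x => (E x).carrier) where
  dist := limDist
  dist_self a := by
    obtain ⟨p, rfl⟩ := mk_surj a
    exact (hasLim_limDist p p).unique (mk_eq_iff_hasLim.1 rfl)
  dist_comm a b := by
    obtain ⟨p, rfl⟩ := mk_surj a
    obtain ⟨q, rfl⟩ := mk_surj b
    exact (hasLim_limDist p q).unique ((hasLim_limDist q p).congr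
      (mem_of_superset (q.pdist p).dom_mem fun x h => ⟨h, ⟨h.2, h.1⟩, dist_comm _ _⟩))
  dist_triangle a b c := by
    obtain ⟨p, rfl⟩ := mk_surj a
    obtain ⟨q, rfl⟩ := mk_surj b
    obtain ⟨r, rfl⟩ := mk_surj c
    refine le_of_forall_pos_lt_add fun ε hε => ?_
    have H := inter_mem (hasLim_limDist p r (ε / 4) (by positivity))
      (inter_mem (hasLim_limDist p q (ε / 4) (by positivity))
        (hasLim_limDist q r (ε / 4) (by positivity)))
    obtain ⟨x, ⟨⟨h₁, h₃⟩, l⟩, ⟨⟨_, h₂⟩, l'⟩, ⟨_, l''⟩⟩ := μ.nonempty_of_mem H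
    have t := dist_triangle (p.val x h₁) (q.val x h₂) (r.val x h₃)
    have l₁ := (abs_lt.1 l).1
    have l₂ := (abs_lt.1 l').2
    have l₃ := (abs_lt.1 l'').2
    simp only [PSec.pdist] at l₁ l₂ l₃
    linarith
  eq_of_dist_eq_zero {a b} h := by
    obtain ⟨p, rfl⟩ := mk_surj a
    obtain ⟨q, rfl⟩ := mk_surj b
    refine mk_eq_iff_hasLim.2 ?_
    rw [← show limDist (mk p) (mk q) = 0 from h]
    exact hasLim_limDist p q

/-- Countable intersections of members of `μ` need not be members, but a section may take
the values of the first one where it is undefined. So the points of a sequence have representatives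
with a common domain. -/
theorem exists_common_dom (a : ℕ → Ultraprod μ fun x => (E x).carrier) :
    ∃ (D : Set X) (hD : D ∈ μ) (q : ℕ → ∀ x, x ∈ D → (E x).carrier),
      ∀ n, mk ⟨D, hD, q n⟩ = a n := by
  classical
  refine ⟨(Quotient.out (a 0)).dom, (Quotient.out (a 0)).dom_mem, fun n x h =>
    if h' : x ∈ (Quotient.out (a n)).dom then (Quotient.out (a n)).val x h'
    else (Quotient.out (a 0)).val x h, fun n => ?_⟩
  refine (mk_eq_of_agree ?_).trans (mk_out (a n))
  exact mem_of_superset (inter_mem (Quotient.out (a 0)).dom_mem (Quotient.out (a n)).dom_mem)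
    fun x ⟨h, h'⟩ => ⟨h, h', dif_pos h'⟩

/-- In a complete space, a sequence that need not be Cauchy has a point that is the right limit as
far as the steps of the sequence are small: if the step from `q j` to `q (j + 1)` is at most
`2⁻¹ ^ j` for all `j < n`, then the point is as close to `q n` as a limit would be. -/
theorem exists_stopped_limit {M : Type w} [MetricSpace M] [CompleteSpace M] (q : ℕ → M) :
    ∃ z, ∀ n, (∀ j < n, dist (q j) (q (j + 1)) ≤ (2⁻¹ : ℝ) ^ j) →
      dist (q n) z ≤ 2 * (2⁻¹ : ℝ) ^ n := by
  classical
  by_cases H : ∀ j, dist (q j) (q (j + 1)) ≤ (2⁻¹ : ℝ) ^ j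
  · have hc : ∀ n, dist (q n) (q (n + 1)) ≤ 1 * (2⁻¹ : ℝ) ^ n := by simpa using H
    obtain ⟨z, hz⟩ := cauchySeq_tendsto_of_complete
      (cauchySeq_of_le_geometric _ _ (by norm_num) hc)
    refine ⟨z, fun n _ => ?_⟩
    have := dist_le_of_le_geometric_of_tendsto _ _ (by norm_num) hc hz n
    convert this using 1
    norm_num
    ring
  · -- stop before the first large step
    push Not at H
    refine ⟨q (Nat.find H), fun n hn => ?_⟩
    have hle : n ≤ Nat.find H := by
      by_contra! h
      exact absurd (hn _ h) (not_le.2 (Nat.find_spec H))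
    have key : ∀ m, n ≤ m → m ≤ Nat.find H →
        dist (q n) (q m) ≤ 2 * (2⁻¹ : ℝ) ^ n - 2 * (2⁻¹ : ℝ) ^ m := by
      intro m hm
      induction m, hm using Nat.le_induction with
      | base => intro _; simp
      | succ m hm ih =>
        intro h
        have h₁ := ih (by omega)
        have h₂ : dist (q m) (q (m + 1)) ≤ (2⁻¹ : ℝ) ^ m :=
          not_lt.1 (Nat.find_min H (by omega))
        have h₃ := dist_triangle (q n) (q m) (q (m + 1))
        have h₄ : (2⁻¹ : ℝ) ^ (m + 1) = 2⁻¹ ^ m * 2⁻¹ := pow_succ _ _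
        rw [h₄]
        linarith
    have := key _ hle le_rfl
    have h₅ : (0 : ℝ) < 2⁻¹ ^ Nat.find H := by positivity
    linarith

/-- Metric ultraproducts of complete spaces are complete, for every ultrafilter: a Cauchy sequence
with rapidly decreasing steps is represented by sequences of points, each of which is followed only
as long as its steps are small. -/
theorem completeSpace (μ : Ultrafilter X) (E : X → CompMet.{w} k) :
    @CompleteSpace _ (metricSpace μ E).toUniformSpace := by
  let := metricSpace μ E
  refine Metric.complete_of_convergent_controlled_sequences (fun n => (2⁻¹ : ℝ) ^ n)
    (fun n => by positivity) fun a ha => ?_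
  obtain ⟨D, hD, q, hq⟩ := exists_common_dom a
  choose z hz using fun x (h : x ∈ D) => exists_stopped_limit fun n => q n x h
  refine ⟨mk ⟨D, hD, z⟩, ?_⟩
  have hstep : ∀ n, {x | ∃ h : x ∈ D, dist (q n x h) (q (n + 1) x h) < (2⁻¹ : ℝ) ^ n} ∈ μ := by
    intro n
    have := ha n n (n + 1) le_rfl (Nat.le_succ n)
    rw [← hq, ← hq] at this
    exact mem_of_superset ((hasLim_limDist _ _).mem_of_lt this) fun x ⟨h, l⟩ => ⟨h.1, l⟩
  have hlim : ∀ n, dist (a n) (mk ⟨D, hD, z⟩) ≤ 2 * (2⁻¹ : ℝ) ^ n := by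
    intro n
    rw [← hq n]
    have hall : {x | ∀ j ∈ Finset.range n,
        ∃ h : x ∈ D, dist (q j x h) (q (j + 1) x h) < (2⁻¹ : ℝ) ^ j} ∈ (μ : Filter X) :=
      (Filter.eventually_all_finset (Finset.range n)).2 fun j _ => hstep j
    refine (hasLim_limDist _ _).le_const (mem_of_superset (inter_mem hall hD) ?_)
    rintro x ⟨hx, h⟩
    exact ⟨⟨h, h⟩, hz x h n fun j hj =>
      (hx j (Finset.mem_range.2 hj)).choose_spec.le⟩
  refine tendsto_iff_dist_tendsto_zero.2 (squeeze_zero (fun _ => dist_nonneg) hlim ?_)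
  simpa using (tendsto_pow_atTop_nhds_zero_of_lt_one (r := (2⁻¹ : ℝ)) (by norm_num)
    (by norm_num)).const_mul 2

end Ultraprod

/-- The metric ultraproduct as an object of the category of complete metric spaces. -/
noncomputable def CompMet.ultraprod {k : ℝ} {X : Type u} (μ : Ultrafilter X)
    (E : X → CompMet.{w} k) : CompMet.{max u w} k where
  carrier := Ultraprod μ fun x => (E x).carrier
  metric := Ultraprod.metricSpace μ E
  complete := Ultraprod.completeSpace μ E
  bounded a b := by
    obtain ⟨p, rfl⟩ := Ultraprod.mk_surj a
    obtain ⟨q, rfl⟩ := Ultraprod.mk_surj b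
    exact (Ultraprod.hasLim_limDist p q).le_const (mem_of_superset (p.pdist q).dom_mem
      fun x h => ⟨h, (E x).bounded _ _⟩)

/-! ### The functor of ultraproducts -/

theorem CompMet.hom_ext {k : ℝ} {X Y : CompMet.{u} k} {f g : X ⟶ Y}
    (h : ∀ a, CompMet.fn f a = CompMet.fn g a) : f = g :=
  Subtype.ext (funext h)

theorem CompMet.fn_map_id {k : ℝ} {A : Type w₁} [Category.{w₂} A] (F : A ⥤ CompMet.{w} k) (c : A)
    (a : (F.obj c).carrier) : CompMet.fn (F.map (𝟙 c)) a = a := by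
  rw [F.map_id]; rfl

theorem CompMet.fn_map_comp {k : ℝ} {A : Type w₁} [Category.{w₂} A] (F : A ⥤ CompMet.{w} k)
    {c d e : A} (f : c ⟶ d) (g : d ⟶ e) (a : (F.obj c).carrier) :
    CompMet.fn (F.map (f ≫ g)) a = CompMet.fn (F.map g) (CompMet.fn (F.map f) a) := by
  rw [F.map_comp]; rfl

section push

variable {k : ℝ} {A : Type w₁} [Category.{w₂} A] (F : A ⥤ CompMet.{w} k) {x y z : Ult.{u} A}

theorem PSec.push_agree {φ ψ : Ult.HomRep x y} (h : φ.sec.Agree ψ.sec)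
    (p : PSec x.uf fun i => (F.obj (x.obj i)).carrier) : (p.push F φ).Agree (p.push F ψ) := by
  refine mem_of_superset (inter_mem h (p.push F φ).dom_mem) ?_
  rintro j ⟨⟨h₁, h₂, e⟩, ⟨_, h₃⟩⟩
  have key : ∀ (a b : Σ i : x.idx, (x.obj i ⟶ y.obj j)) (_ : a = b) (ha : a.1 ∈ p.dom),
      ∃ hb : b.1 ∈ p.dom, CompMet.fn (F.map a.2) (p.val _ ha) =
        CompMet.fn (F.map b.2) (p.val _ hb) := by
    rintro a _ rfl ha
    exact ⟨ha, rfl⟩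
  obtain ⟨h₄, e'⟩ := key _ _ e h₃
  exact ⟨⟨h₁, h₃⟩, ⟨h₂, h₄⟩, e'⟩

theorem PSec.hasLim_pdist_push_le (φ : Ult.HomRep x y)
    (p q : PSec x.uf fun i => (F.obj (x.obj i)).carrier) {r r' : ℝ}
    (h : (p.pdist q).HasLim r) (h' : ((p.push F φ).pdist (q.push F φ)).HasLim r') : r' ≤ r := by
  refine le_of_forall_gt_imp_ge_of_dense fun c hc => h'.le_const ?_
  refine mem_of_superset ((φ.push _).1 (h.mem_of_lt hc)) ?_
  rintro j ⟨h₁, ⟨h₂, h₃⟩, l⟩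
  exact ⟨⟨⟨h₁, h₂⟩, ⟨h₁, h₃⟩⟩, ((F.map (φ.sec.val j h₁).2).2 _ _).trans l.le⟩

theorem Ultraprod.mk_push_congr {φ ψ : Ult.HomRep x y} (h : Ult.homMk φ = Ult.homMk ψ)
    {p q : PSec x.uf fun i => (F.obj (x.obj i)).carrier}
    (hpq : (mk p : Ultraprod x.uf fun i => (F.obj (x.obj i)).carrier) = mk q) :
    (mk (p.push F φ) : Ultraprod y.uf fun i => (F.obj (y.obj i)).carrier) = mk (q.push F ψ) := by
  refine Eq.trans ?_ (mk_eq_of_agree (PSec.push_agree F (Ult.homMk_eq.1 h) q))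
  refine mk_eq_iff_hasLim.2 ?_
  obtain ⟨r, hr⟩ := exists_hasLim_pdist (p.push F φ) (q.push F φ)
  have h0 : r ≤ 0 := PSec.hasLim_pdist_push_le F φ p q (mk_eq_iff_hasLim.1 hpq) hr
  have h1 : 0 ≤ r := hr.const_le (mem_of_superset (PSec.pdist _ _).dom_mem
    fun _ h => ⟨h, dist_nonneg⟩)
  rwa [le_antisymm h0 h1] at hr

/-- The map of ultraproducts induced by a morphism of formal ultraproducts. -/
noncomputable def Ultraprod.pushHom (f : x ⟶ y)
    (a : Ultraprod x.uf fun i => (F.obj (x.obj i)).carrier) :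
    Ultraprod y.uf fun i => (F.obj (y.obj i)).carrier :=
  mk ((Quotient.out a).push F (Ult.rep f))

theorem Ultraprod.pushHom_mk (φ : Ult.HomRep x y)
    (p : PSec x.uf fun i => (F.obj (x.obj i)).carrier) :
    pushHom F (Ult.homMk φ) (mk p) = mk (p.push F φ) :=
  mk_push_congr F (Ult.homMk_rep _) (mk_out _)

theorem Ultraprod.pushHom_id (a : Ultraprod x.uf fun i => (F.obj (x.obj i)).carrier) :
    pushHom F (𝟙 x) a = a := by
  obtain ⟨p, rfl⟩ := mk_surj a
  rw [Ult.id_eq, pushHom_mk]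
  exact mk_eq_of_agree (mem_of_superset p.dom_mem fun i h =>
    ⟨⟨trivial, h⟩, h, CompMet.fn_map_id F _ _⟩)

theorem Ultraprod.pushHom_comp (f : x ⟶ y) (g : y ⟶ z)
    (a : Ultraprod x.uf fun i => (F.obj (x.obj i)).carrier) :
    pushHom F (f ≫ g) a = pushHom F g (pushHom F f a) := by
  obtain ⟨p, rfl⟩ := mk_surj a
  obtain ⟨φ, rfl⟩ := Ult.homMk_surj f
  obtain ⟨ψ, rfl⟩ := Ult.homMk_surj g
  rw [Ult.homMk_comp, pushHom_mk, pushHom_mk, pushHom_mk]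
  refine mk_eq_of_agree (mem_of_superset (p.push F (φ.comp ψ)).dom_mem ?_)
  rintro i ⟨⟨h₁, h₂⟩, h₃⟩
  exact ⟨⟨⟨h₁, h₂⟩, h₃⟩, ⟨h₁, h₂, h₃⟩, CompMet.fn_map_comp F _ _ _⟩

end push

theorem Ultraprod.dist_pushHom_le {k : ℝ} {A : Type w₁} [Category.{w₂} A] (F : A ⥤ CompMet.{w} k)
    {x y : Ult.{u} A} (f : x ⟶ y)
    (a b : (CompMet.ultraprod x.uf fun i => F.obj (x.obj i)).carrier) :
    dist (α := (CompMet.ultraprod y.uf fun i => F.obj (y.obj i)).carrier)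
      (pushHom F f a) (pushHom F f b) ≤ dist a b := by
  obtain ⟨p, rfl⟩ := mk_surj a
  obtain ⟨q, rfl⟩ := mk_surj b
  obtain ⟨φ, rfl⟩ := Ult.homMk_surj f
  rw [pushHom_mk, pushHom_mk]
  exact PSec.hasLim_pdist_push_le F φ p q (hasLim_limDist p q) (hasLim_limDist _ _)

/-! ### The standard unitor and associator of an ultraproduct functor -/

/-- The data that exhibit a functor `m : Ult A ⥤ A`, after the functor `F` to metric spaces, as the
metric ultraproduct. In contrast to `ColaxAlgebra.UltraproductData`, no unitor and no associator
are given. -/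
structure ActionData {A : Type w₁} [Category.{w₂} A] (m : Ult.{u} A ⥤ A)
    {k : ℝ} (F : A ⥤ CompMet.{w} k) where
  /-- the points of `F (m x)` are the points of the ultraproduct of the `F (x.obj i)` -/
  pt : ∀ x : Ult.{u} A,
    Ultraprod x.uf (fun i => (F.obj (x.obj i)).carrier) ≃ (F.obj (m.obj x)).carrier
  /-- the distance is the limit of the distances -/
  dist_lim : ∀ (x : Ult.{u} A) (p q : PSec x.uf fun i => (F.obj (x.obj i)).carrier),
    (p.pdist q).HasLim (dist (pt x (Ultraprod.mk p)) (pt x (Ultraprod.mk q)))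
  /-- the action on morphisms -/
  map_pt : ∀ {x y : Ult.{u} A} (φ : Ult.HomRep x y)
    (p : PSec x.uf fun i => (F.obj (x.obj i)).carrier),
    CompMet.fn (F.map (m.map (Ult.homMk φ))) (pt x (Ultraprod.mk p)) =
      pt y (Ultraprod.mk (p.push F φ))

namespace ActionData

variable {A : Type w₁} [Category.{w₂} A] {m : Ult.{u} A ⥤ A} {k : ℝ} {F : A ⥤ CompMet.{w} k}
  (D : ActionData m F)

theorem pt_surj (x : Ult.{u} A) (a : (F.obj (m.obj x)).carrier) :
    ∃ p, D.pt x (Ultraprod.mk p) = a := by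
  obtain ⟨b, rfl⟩ := (D.pt x).surjective a
  obtain ⟨p, rfl⟩ := Ultraprod.mk_surj b
  exact ⟨p, rfl⟩

theorem pt_eq_of_agree {x : Ult.{u} A} {p q : PSec x.uf fun i => (F.obj (x.obj i)).carrier}
    (h : p.Agree q) : D.pt x (Ultraprod.mk p) = D.pt x (Ultraprod.mk q) :=
  congrArg _ (Ultraprod.mk_eq_of_agree h)

/-- The classes of the restrictions of a partial section to the summands of a disjoint union. -/
def fiber (x : Ult.{u} (Ult.{u} A))
    (q : PSec (Ult.mult.obj x).uf fun p => (F.obj ((Ult.mult.obj x).obj p)).carrier) :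
    PSec ((Ult.map m).obj x).uf fun s => (F.obj (((Ult.map m).obj x).obj s)).carrier :=
  (PSec.curry (E := fun c => (F.obj c).carrier) q).map fun s r => D.pt (x.obj s) (Ultraprod.mk r)

theorem dist_fiber (x : Ult.{u} (Ult.{u} A))
    (p q : PSec (Ult.mult.obj x).uf fun p => (F.obj ((Ult.mult.obj x).obj p)).carrier) :
    dist (D.pt _ (Ultraprod.mk (D.fiber x p))) (D.pt _ (Ultraprod.mk (D.fiber x q))) =
      dist (D.pt _ (Ultraprod.mk p)) (D.pt _ (Ultraprod.mk q)) := by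
  refine (D.dist_lim _ (D.fiber x p) (D.fiber x q)).unique
    (PSec.HasLim.curry (D.dist_lim (Ult.mult.obj x) p q) ?_)
  rintro s ⟨h, h'⟩ _
  exact D.dist_lim (x.obj s) ((PSec.curry (E := fun c => (F.obj c).carrier) p).val s h)
    ((PSec.curry (E := fun c => (F.obj c).carrier) q).val s h')

/-- The comparison of the ultraproduct over a disjoint union with the iterated ultraproduct. -/
noncomputable def comparison (x : Ult.{u} (Ult.{u} A))
    (a : (F.obj (m.obj (Ult.mult.obj x))).carrier) :
    (F.obj (m.obj ((Ult.map m).obj x))).carrier :=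
  D.pt _ (Ultraprod.mk (D.fiber x (D.pt_surj _ a).choose))

theorem comparison_pt (x : Ult.{u} (Ult.{u} A))
    (q : PSec (Ult.mult.obj x).uf fun p => (F.obj ((Ult.mult.obj x).obj p)).carrier) :
    D.comparison x (D.pt _ (Ultraprod.mk q)) = D.pt _ (Ultraprod.mk (D.fiber x q)) := by
  refine eq_of_dist_eq_zero ((D.dist_fiber x _ q).trans ?_)
  rw [(D.pt_surj _ (D.pt _ (Ultraprod.mk q))).choose_spec, dist_self]

theorem dist_comparison (x : Ult.{u} (Ult.{u} A))
    (a b : (F.obj (m.obj (Ult.mult.obj x))).carrier) :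
    dist (D.comparison x a) (D.comparison x b) = dist a b := by
  obtain ⟨p, rfl⟩ := D.pt_surj _ a
  obtain ⟨q, rfl⟩ := D.pt_surj _ b
  rw [comparison_pt, comparison_pt, dist_fiber]

/-- Every section of classes is the section of the classes of one section over the disjoint
union. -/
theorem comparison_bijective (x : Ult.{u} (Ult.{u} A)) :
    Function.Bijective (D.comparison x) := by
  refine ⟨fun a b h => eq_of_dist_eq_zero ?_, fun b => ?_⟩
  · rw [← D.dist_comparison, h, dist_self]
  · obtain ⟨r, rfl⟩ := D.pt_surj _ b
    choose q hq using fun s (h : s ∈ r.dom) => D.pt_surj (x.obj s) (r.val s h)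
    refine ⟨D.pt _ (Ultraprod.mk ⟨{p | ∃ h : p.1 ∈ r.dom, p.2 ∈ (q p.1 h).dom},
      Ult.mem_sigmaUf.2 (mem_of_superset r.dom_mem fun s h =>
        mem_of_superset (q s h).dom_mem fun t h' => ⟨h, h'⟩),
      fun p hp => (q p.1 hp.1).val p.2 hp.2⟩), ?_⟩
    rw [comparison_pt]
    refine D.pt_eq_of_agree (mem_of_superset r.dom_mem fun s h => ?_)
    refine ⟨mem_of_superset (q s h).dom_mem fun t h' => ⟨h, h'⟩, h, Eq.trans ?_ (hq s h)⟩
    exact D.pt_eq_of_agree (mem_of_superset (q s h).dom_mem fun t h' => ⟨⟨h, h'⟩, h', rfl⟩)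

/-- A set of the principal ultrafilter on a point contains the point. -/
theorem star_mem_dom {E : PUnit.{u + 1} → Type w} (p : PSec (pure PUnit.unit) E) :
    PUnit.unit ∈ p.dom := p.dom_mem

/-- The entry of a one-point family. -/
noncomputable def entry (c : A) (a : (F.obj (m.obj (Ult.unit.obj c))).carrier) :
    (F.obj c).carrier :=
  (D.pt_surj _ a).choose.val PUnit.unit (star_mem_dom _)

theorem dist_entry (c : A) (a b : (F.obj (m.obj (Ult.unit.obj c))).carrier) :
    dist (D.entry c a) (D.entry c b) = dist a b := by
  have h := D.dist_lim _ (D.pt_surj _ a).choose (D.pt_surj _ b).choose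
  rw [(D.pt_surj _ a).choose_spec, (D.pt_surj _ b).choose_spec] at h
  refine PSec.HasLim.unique (fun ε hε => ?_) h
  exact Filter.mem_pure.2 ⟨⟨star_mem_dom _, star_mem_dom _⟩,
    (abs_eq_zero.2 (sub_self (dist (D.entry c a) (D.entry c b)))).trans_lt hε⟩

theorem entry_pt (c : A) (p : PSec (Ult.unit.{u}.obj c).uf fun _ => (F.obj c).carrier)
    (h : PUnit.unit ∈ p.dom) : D.entry c (D.pt (Ult.unit.obj c) (Ultraprod.mk p)) =
      p.val PUnit.unit h := by
  have H := (D.pt_surj _ (D.pt (Ult.unit.obj c) (Ultraprod.mk p))).choose_spec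
  have H' := Ultraprod.mk_eq_iff_hasLim.1 ((D.pt _).injective H)
  refine eq_of_dist_eq_zero (PSec.HasLim.unique (fun ε hε => ?_) H')
  exact Filter.mem_pure.2 ⟨⟨star_mem_dom _, h⟩,
    (abs_eq_zero.2 (sub_self (dist (D.entry c _) (p.val PUnit.unit h)))).trans_lt hε⟩

theorem entry_bijective (c : A) : Function.Bijective (D.entry c) := by
  refine ⟨fun a b h => eq_of_dist_eq_zero ?_, fun b => ?_⟩
  · rw [← D.dist_entry, h, dist_self]
  · exact ⟨D.pt (Ult.unit.obj c) (Ultraprod.mk ⟨Set.univ, univ_mem, fun _ _ => b⟩),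
      D.entry_pt c ⟨Set.univ, univ_mem, fun _ _ => b⟩ trivial⟩

/-! ### The laws of a colax algebra -/

section laws

variable {i : ∀ c : A, m.obj (Ult.unit.obj c) ⟶ c}
  {a : ∀ x : Ult.{u} (Ult.{u} A), m.obj (Ult.mult.obj x) ⟶ m.obj ((Ult.map m).obj x)}

theorem unitor_naturality (hi : ∀ c b, CompMet.fn (F.map (i c)) b = D.entry c b) {c c' : A}
    (g : c ⟶ c') : F.map (m.map (Ult.unit.map g) ≫ i c') = F.map (i c ≫ g) := by
  refine CompMet.hom_ext fun b => ?_
  obtain ⟨p, rfl⟩ := D.pt_surj _ b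
  rw [CompMet.fn_map_comp, CompMet.fn_map_comp, hi, hi]
  refine (congrArg (D.entry c') (D.map_pt _ p)).trans ?_
  have h : PUnit.unit ∈ {j | ∃ _ : j ∈ (Set.univ : Set PUnit.{u + 1}), j ∈ p.dom} :=
    ⟨trivial, star_mem_dom p⟩
  refine (D.entry_pt c' _ h).trans ?_
  exact congrArg (CompMet.fn (F.map g)) (D.entry_pt c p (star_mem_dom p)).symm

theorem associator_naturality (ha : ∀ x b, CompMet.fn (F.map (a x)) b = D.comparison x b)
    {x y : Ult.{u} (Ult.{u} A)} (f : x ⟶ y) :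
    F.map (m.map (Ult.mult.map f) ≫ a y) = F.map (a x ≫ m.map ((Ult.map m).map f)) := by
  refine CompMet.hom_ext fun b => ?_
  obtain ⟨q, rfl⟩ := D.pt_surj _ b
  obtain ⟨φ, rfl⟩ := Ult.homMk_surj f
  rw [CompMet.fn_map_comp, CompMet.fn_map_comp, ha, ha, comparison_pt]
  refine (congrArg (D.comparison y) (D.map_pt φ.multRep q)).trans ?_
  refine Eq.trans ?_ (D.map_pt (φ.mapRep m) (D.fiber x q)).symm
  refine (D.comparison_pt y (q.push F φ.multRep)).trans ?_
  refine D.pt_eq_of_agree (mem_of_superset (inter_mem (D.fiber y (q.push F φ.multRep)).dom_mem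
    ((D.fiber x q).push F (φ.mapRep m)).dom_mem) ?_)
  rintro s ⟨h, h'⟩
  refine ⟨h, h', ?_⟩
  obtain ⟨h₁, h₂⟩ := h'
  -- over `s`, the morphism of `φ` may be replaced by its chosen representative
  have e := D.map_pt (Ult.rep (φ.sec.val s h₁).2)
    ((PSec.curry (E := fun c => (F.obj c).carrier) q).val _ h₂)
  rw [Ult.homMk_rep] at e
  refine Eq.trans ?_ e.symm
  refine D.pt_eq_of_agree (mem_of_superset (PSec.dom_mem (PSec.push F (Ult.rep (φ.sec.val s h₁).2)
    ((PSec.curry (E := fun c => (F.obj c).carrier) q).val _ h₂))) ?_)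
  rintro t ⟨k₂, k₃⟩
  exact ⟨⟨⟨h₁, k₂⟩, k₃⟩, ⟨k₂, k₃⟩, rfl⟩

theorem left_unit (hi : ∀ c b, CompMet.fn (F.map (i c)) b = D.entry c b)
    (ha : ∀ x b, CompMet.fn (F.map (a x)) b = D.comparison x b) (x : Ult.{u} A) :
    F.map (m.map (Ult.unitHomLeft x) ≫ a (Ult.unit.obj x) ≫ i (m.obj x)) =
      F.map (𝟙 (m.obj x)) := by
  refine CompMet.hom_ext fun b => ?_
  obtain ⟨p, rfl⟩ := D.pt_surj _ b
  have e := D.map_pt (x := x) (y := Ult.mult.obj (Ult.unit.obj x))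
    (Ult.HomRep.ofFun (fun p => p.2) (by ext W; rfl) fun _ => 𝟙 _) p
  refine (CompMet.fn_map_comp F _ _ _).trans ((congrArg _ e).trans
    ((CompMet.fn_map_comp F _ _ _).trans ((hi _ _).trans ?_)))
  have H : {t | ∃ _ : t ∈ (Set.univ : Set x.idx), t ∈ p.dom} ∈ x.uf :=
    mem_of_superset p.dom_mem fun t h => ⟨trivial, h⟩
  refine (congrArg (D.entry _) ((ha _ _).trans (D.comparison_pt (Ult.unit.obj x) _))).trans ?_
  refine ((D.entry_pt (m.obj x) _ H).trans ?_).trans (CompMet.fn_map_id F _ _).symm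
  exact D.pt_eq_of_agree (mem_of_superset p.dom_mem fun t h =>
    ⟨⟨trivial, h⟩, h, CompMet.fn_map_id F _ _⟩)

theorem right_unit {i : Ult.unit.{u} ⋙ m ⟶ 𝟭 A}
    (hi : ∀ c b, CompMet.fn (F.map (i.app c)) b = D.entry c b)
    (ha : ∀ x b, CompMet.fn (F.map (a x)) b = D.comparison x b) (x : Ult.{u} A) :
    F.map (m.map (Ult.unitHomRight x) ≫ a ((Ult.map Ult.unit).obj x) ≫
      m.map ((Ult.mapNat i).app x)) = F.map (𝟙 (m.obj x)) := by
  refine CompMet.hom_ext fun b => ?_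
  obtain ⟨p, rfl⟩ := D.pt_surj _ b
  have e := D.map_pt (x := x) (y := Ult.mult.obj ((Ult.map Ult.unit).obj x))
    (Ult.HomRep.ofFun (fun p => p.1) (by ext W; rfl) fun _ => 𝟙 _) p
  refine (CompMet.fn_map_comp F _ _ _).trans ((congrArg _ e).trans
    ((CompMet.fn_map_comp F _ _ _).trans ?_))
  refine (congrArg (CompMet.fn (F.map (m.map ((Ult.mapNat i).app x))))
    ((ha _ _).trans (D.comparison_pt ((Ult.map Ult.unit).obj x) _))).trans ?_
  refine Eq.trans ?_ (CompMet.fn_map_id F _ _).symm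
  refine (D.map_pt (Ult.HomRep.ofFun (x := (Ult.map (Ult.unit ⋙ m)).obj x)
    (y := (Ult.map (𝟭 A)).obj x) id (Ultrafilter.map_id _) fun j => i.app (x.obj j)) _).trans ?_
  refine D.pt_eq_of_agree (mem_of_superset p.dom_mem fun t h => ?_)
  have H' : PUnit.unit ∈ {_s : PUnit.{u + 1} | ∃ _ : t ∈ (Set.univ : Set x.idx), t ∈ p.dom} :=
    ⟨trivial, h⟩
  have H : {_s : PUnit.{u + 1} | ∃ _ : t ∈ (Set.univ : Set x.idx), t ∈ p.dom} ∈
      (pure PUnit.unit : Ultrafilter PUnit.{u + 1}) := Filter.mem_pure.2 H'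
  refine ⟨⟨trivial, H⟩, h, ?_⟩
  refine (hi (x.obj t) _).trans ((D.entry_pt (x.obj t) _ H').trans ?_)
  exact CompMet.fn_map_id F _ _

theorem assoc {a : Ult.mult.{u} ⋙ m ⟶ Ult.map.{u} m ⋙ m}
    (ha : ∀ x b, CompMet.fn (F.map (a.app x)) b = D.comparison x b)
    (x : Ult.{u} (Ult.{u} (Ult.{u} A))) :
    F.map (a.app ((Ult.map Ult.mult).obj x) ≫ m.map ((Ult.mapNat a).app x)) =
      F.map (m.map (Ult.assocHom x) ≫ a.app (Ult.mult.obj x) ≫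
        a.app ((Ult.map (Ult.map m)).obj x)) := by
  refine CompMet.hom_ext fun b => ?_
  obtain ⟨q, rfl⟩ := D.pt_surj _ b
  have e := D.map_pt (x := Ult.mult.obj ((Ult.map Ult.mult).obj x))
    (y := Ult.mult.obj (Ult.mult.obj x))
    (Ult.HomRep.ofFun (fun p => ⟨p.1.1, p.1.2, p.2⟩) (by ext W; rfl) fun _ => 𝟙 _) q
  refine Eq.trans ?_ ((CompMet.fn_map_comp F _ _ _).trans ((congrArg _ e).trans
    (CompMet.fn_map_comp F _ _ _))).symm
  refine Eq.trans ?_ (congrArg (CompMet.fn (F.map (a.app ((Ult.map (Ult.map m)).obj x))))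
    ((ha _ _).trans (D.comparison_pt (Ult.mult.obj x) _))).symm
  refine Eq.trans ?_ ((ha _ _).trans (D.comparison_pt ((Ult.map (Ult.map m)).obj x) _)).symm
  refine (CompMet.fn_map_comp F _ _ _).trans ?_
  refine (congrArg (CompMet.fn (F.map (m.map ((Ult.mapNat a).app x))))
    ((ha _ _).trans (D.comparison_pt ((Ult.map Ult.mult).obj x) q))).trans ?_
  refine (D.map_pt (Ult.HomRep.ofFun (x := (Ult.map (Ult.mult ⋙ m)).obj x)
    (y := (Ult.map (Ult.map m ⋙ m)).obj x) id (Ultrafilter.map_id _)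
    fun j => a.app (x.obj j)) _).trans ?_
  refine D.pt_eq_of_agree (mem_of_superset (D.fiber ((Ult.map Ult.mult).obj x) q).dom_mem
    fun r h => ?_)
  have h' : {s | {t | ∃ _ : (⟨⟨r, s⟩, t⟩ : (Ult.mult.obj (Ult.mult.obj x)).idx) ∈
      (Set.univ : Set (Ult.mult.obj (Ult.mult.obj x)).idx), (⟨r, s, t⟩ :
        (Ult.mult.obj ((Ult.map Ult.mult).obj x)).idx) ∈ q.dom} ∈ ((x.obj r).obj s).uf} ∈
      (x.obj r).uf :=
    mem_of_superset (Ult.mem_sigmaUf.1 h) fun s hs => mem_of_superset hs fun t ht => ⟨trivial, ht⟩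
  refine ⟨⟨trivial, h⟩, h', ?_⟩
  refine (ha (x.obj r) _).trans ((D.comparison_pt (x.obj r) _).trans ?_)
  refine D.pt_eq_of_agree (mem_of_superset (Ult.mem_sigmaUf.1 h) fun s hs => ?_)
  refine ⟨hs, mem_of_superset hs fun t ht => ⟨trivial, ht⟩, ?_⟩
  exact D.pt_eq_of_agree (mem_of_superset hs fun t ht =>
    ⟨ht, ⟨trivial, ht⟩, (CompMet.fn_map_id F _ _).symm⟩)

end laws

end ActionData

/-! ### Unitor and associator of an ultraproduct algebra are bijective isometries -/

namespace ColaxAlgebra.UltraproductData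

variable {A : Type w₁} [Category.{w₂} A] {P : ColaxAlgebra.{u} A} {k : ℝ} {F : A ⥤ CompMet.{w} k}
  (D : P.UltraproductData F)

/-- The action part of the data of an ultraproduct algebra. -/
def toActionData : ActionData P.m F := ⟨D.pt, D.dist_lim, D.map_pt⟩

theorem fn_unitor (c : A) : CompMet.fn (F.map (P.i.app c)) = D.toActionData.entry c := by
  funext b
  obtain ⟨p, rfl⟩ := D.toActionData.pt_surj _ b
  exact (D.unit_pt c p (ActionData.star_mem_dom p)).trans
    (D.toActionData.entry_pt c p (ActionData.star_mem_dom p)).symm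

theorem fn_associator (x : Ult.{u} (Ult.{u} A)) :
    CompMet.fn (F.map (P.a.app x)) = D.toActionData.comparison x := by
  funext b
  obtain ⟨p, rfl⟩ := D.toActionData.pt_surj _ b
  exact (D.assoc_pt x p).trans (D.toActionData.comparison_pt x p).symm

theorem unitor_bijective (D : P.UltraproductData F) (c : A) :
    Function.Bijective (CompMet.fn (F.map (P.i.app c))) := by
  rw [D.fn_unitor]; exact D.toActionData.entry_bijective c

theorem associator_bijective (D : P.UltraproductData F) (x : Ult.{u} (Ult.{u} A)) :
    Function.Bijective (CompMet.fn (F.map (P.a.app x))) := by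
  rw [D.fn_associator]; exact D.toActionData.comparison_bijective x

end ColaxAlgebra.UltraproductData

theorem ColaxAlgebra.isPseudoAlgebra_of_isIso {A : Type w₁} [Category.{w₂} A]
    {P : ColaxAlgebra.{u} A} (hi : ∀ c, IsIso (P.i.app c)) (ha : ∀ x, IsIso (P.a.app x)) :
    P.IsPseudoAlgebra :=
  ⟨(NatTrans.isIso_iff_isIso_app P.i).2 hi, (NatTrans.isIso_iff_isIso_app P.a).2 ha⟩

/-! ### Complete metric spaces -/

namespace CompMet

variable {k : ℝ}

theorem isIso_of_isometry {X Y : CompMet.{u} k} (f : X ⟶ Y) (hf : Function.Bijective (fn f))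
    (hd : ∀ a b, dist (fn f a) (fn f b) = dist a b) : IsIso f := by
  obtain ⟨g, hg, hg'⟩ := Function.bijective_iff_has_inverse.1 hf
  refine ⟨⟨g, fun a b => ?_⟩, hom_ext hg, hom_ext hg'⟩
  rw [← hd, hg', hg']

/-- The metric ultraproduct as a functor. -/
noncomputable def action (k : ℝ) : Ult.{u} (CompMet.{u} k) ⥤ CompMet.{u} k where
  obj x := ultraprod x.uf x.obj
  map f := ⟨Ultraprod.pushHom (𝟭 _) f, Ultraprod.dist_pushHom_le (𝟭 _) f⟩
  map_id _ := hom_ext (Ultraprod.pushHom_id (𝟭 _))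
  map_comp f g := hom_ext (Ultraprod.pushHom_comp (𝟭 _) f g)

/-- The points of `action k` are the points of the ultraproduct. -/
noncomputable def actionData (k : ℝ) : ActionData (action.{u} k) (𝟭 _) where
  pt _ := Equiv.refl _
  dist_lim _ p q := Ultraprod.hasLim_limDist p q
  map_pt φ p := Ultraprod.pushHom_mk (𝟭 _) φ p

/-- The standard unitor. -/
noncomputable def unitorHom (c : CompMet.{u} k) : (action.{u} k).obj (Ult.unit.obj c) ⟶ c :=
  ⟨(actionData.{u} k).entry c, fun a b => ((actionData.{u} k).dist_entry c a b).le⟩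

/-- The standard associator. -/
noncomputable def associatorHom (x : Ult.{u} (Ult.{u} (CompMet.{u} k))) :
    (action.{u} k).obj (Ult.mult.obj x) ⟶ (action.{u} k).obj ((Ult.map (action.{u} k)).obj x) :=
  ⟨(actionData.{u} k).comparison x, fun a b => ((actionData.{u} k).dist_comparison x a b).le⟩

/-- The ultraproduct algebra of complete metric spaces. -/
noncomputable def algebra (k : ℝ) : ColaxAlgebra.{u} (CompMet.{u} k) where
  m := action.{u} k
  i :=
    { app := unitorHom
      naturality _ _ g :=
        (actionData.{u} k).unitor_naturality (i := unitorHom) (fun _ _ => rfl) g }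
  a :=
    { app := associatorHom
      naturality _ _ f :=
        (actionData.{u} k).associator_naturality (a := associatorHom) (fun _ _ => rfl) f }
  left_unit x := (actionData.{u} k).left_unit (i := unitorHom) (a := associatorHom)
    (fun _ _ => rfl) (fun _ _ => rfl) x
  right_unit x := (actionData.{u} k).right_unit (a := associatorHom)
    (fun _ _ => rfl) (fun _ _ => rfl) x
  assoc x := (actionData.{u} k).assoc (fun _ _ => rfl) x

theorem algebra_isUltraproductAlgebra (k : ℝ) : IsUltraproductAlgebra (algebra.{u} k) :=
  ⟨{ pt := (actionData.{u} k).pt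
     dist_lim := (actionData.{u} k).dist_lim
     map_pt := (actionData.{u} k).map_pt
     unit_pt := (actionData.{u} k).entry_pt
     assoc_pt := (actionData.{u} k).comparison_pt }⟩

theorem IsUltraproductAlgebra.isPseudoAlgebra {P : ColaxAlgebra.{u} (CompMet.{u} k)}
    (h : IsUltraproductAlgebra P) : P.IsPseudoAlgebra := by
  obtain ⟨D⟩ := h
  refine ColaxAlgebra.isPseudoAlgebra_of_isIso
    (fun c => isIso_of_isometry _ (D.unitor_bijective c) fun a b => ?_)
    (fun x => isIso_of_isometry _ (D.associator_bijective x) fun a b => ?_)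
  · have := D.toActionData.dist_entry c a b
    rwa [← D.fn_unitor] at this
  · have := D.toActionData.dist_comparison x a b
    rwa [← D.fn_associator] at this

end CompMet

/-! ### Tuples, suprema and infima along an ultrafilter -/

namespace PSec

variable {X : Type u} {μ : Ultrafilter X}

theorem tuple_close {n : ℕ} {F : Fin n → X → Type w} [∀ j x, MetricSpace (F j x)]
    {p q : ∀ j, PSec μ (F j)} {δ : ℝ}
    (H : ∀ j, {x | ∃ (h : x ∈ (p j).dom) (h' : x ∈ (q j).dom),
      dist ((p j).val x h) ((q j).val x h') < δ} ∈ μ) :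
    {x | ∃ (h : x ∈ (tuple p).dom) (h' : x ∈ (tuple q).dom),
      ∀ j, dist ((tuple p).val x h j) ((tuple q).val x h' j) < δ} ∈ μ :=
  mem_of_superset ((eventually_all (l := (μ : Filter X))).2 H) fun _ hx =>
    ⟨fun j => (hx j).choose, fun j => (hx j).choose_spec.choose,
      fun j => (hx j).choose_spec.choose_spec⟩

/-- Evaluation of a partial section of functions at a partial section. -/
def app {E : X → Type w} (g : PSec μ fun x => E x → ℝ) (p : PSec μ E) : PSec μ (fun _ => ℝ) where
  dom := g.dom ∩ p.dom
  dom_mem := inter_mem g.dom_mem p.dom_mem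
  val x h := g.val x h.1 (p.val x h.2)

/-- Suprema commute with limits along an ultrafilter, if the function `G` on the type `T` of
classes of sections has as values the limits of the values of the functions `g x`. An upper bound
of the suprema is found by choosing almost maximal arguments for the `g x`. -/
theorem hasLim_sSup {E : X → Type w} {T : Type w₁} (cls : PSec μ E → T)
    (hcls : Function.Surjective cls) (g : PSec μ fun x => E x → ℝ) (G : T → ℝ)
    (hG : ∀ p, (g.app p).HasLim (G (cls p))) {lo hi : ℝ} (hlo : lo ≤ hi)
    (hg : ∀ x h a, g.val x h a ≤ hi) :
    (g.map fun _ f => sSup (insert lo (Set.range f))).HasLim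
      (sSup (insert lo (Set.range G))) := by
  have hbdd : ∀ x h, BddAbove (insert lo (Set.range (g.val x h))) := fun x h =>
    ⟨hi, by rintro _ (rfl | ⟨a, rfl⟩); exacts [hlo, hg x h a]⟩
  have hbddG : BddAbove (insert lo (Set.range G)) := by
    refine ⟨hi, ?_⟩
    rintro _ (rfl | ⟨a, rfl⟩)
    · exact hlo
    · obtain ⟨p, rfl⟩ := hcls a
      exact (hG p).le_const (mem_of_superset (g.app p).dom_mem fun x h => ⟨h, hg x h.1 _⟩)
  set V := sSup (insert lo (Set.range G)) with hV
  have lower : ∀ ε > 0,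
      {x | ∃ h : x ∈ g.dom, V - ε < sSup (insert lo (Set.range (g.val x h)))} ∈ μ := by
    intro ε hε
    obtain ⟨b, hb, hlt⟩ := exists_lt_of_lt_csSup (Set.insert_nonempty lo (Set.range G))
      (show V - ε < sSup (insert lo (Set.range G)) by linarith)
    rcases hb with rfl | ⟨a, rfl⟩
    · exact mem_of_superset g.dom_mem fun x h =>
        ⟨h, hlt.trans_le (le_csSup (hbdd x h) (Set.mem_insert _ _))⟩
    · obtain ⟨p, rfl⟩ := hcls a
      exact mem_of_superset ((hG p).mem_of_gt hlt) fun x ⟨h, l⟩ =>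
        ⟨h.1, l.trans_le (le_csSup (hbdd x h.1) (Set.mem_insert_of_mem _ ⟨_, rfl⟩))⟩
  have upper : ∀ ε > 0,
      {x | ∃ h : x ∈ g.dom, sSup (insert lo (Set.range (g.val x h))) < V + ε} ∈ μ := by
    intro ε hε
    by_contra hn
    have hW : {x | ∃ (h : x ∈ g.dom) (a : E x), V + ε / 2 < g.val x h a} ∈ μ := by
      refine mem_of_superset (inter_mem (Ultrafilter.compl_mem_iff_notMem.2 hn) g.dom_mem) ?_
      rintro x ⟨hx, h⟩
      have hle : V + ε ≤ sSup (insert lo (Set.range (g.val x h))) :=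
        not_lt.1 fun l => hx ⟨h, l⟩
      obtain ⟨b, hb, hlt⟩ := exists_lt_of_lt_csSup
        (Set.insert_nonempty lo (Set.range (g.val x h)))
        (show V + ε / 2 < sSup (insert lo (Set.range (g.val x h))) by linarith)
      rcases hb with rfl | ⟨a, rfl⟩
      · have : b ≤ V := le_csSup hbddG (Set.mem_insert _ _)
        linarith
      · exact ⟨h, a, hlt⟩
    choose d a ha using fun x (h : x ∈ {x | ∃ (h : x ∈ g.dom) (a : E x),
      V + ε / 2 < g.val x h a}) => h
    have h₁ := (hG ⟨_, hW, a⟩).const_le (c := V + ε / 2)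
      (mem_of_superset hW fun x h => ⟨⟨d x h, h⟩, (ha x h).le⟩)
    have h₂ : G (cls ⟨_, hW, a⟩) ≤ V :=
      le_csSup hbddG (Set.mem_insert_of_mem _ ⟨_, rfl⟩)
    linarith
  intro ε hε
  refine mem_of_superset (inter_mem (lower ε hε) (upper ε hε)) ?_
  rintro x ⟨⟨h, l⟩, ⟨_, l'⟩⟩
  exact ⟨h, abs_lt.2 ⟨by simp only [PSec.map]; linarith, by simp only [PSec.map]; linarith⟩⟩

theorem sInf_insert_range {T : Type w} (c : ℝ) (f : T → ℝ) :
    sInf (insert c (Set.range f)) = -sSup (insert (-c) (Set.range fun a => -f a)) := by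
  rw [Real.sInf_def]
  congr 2
  ext y
  simp [Set.mem_neg, neg_eq_iff_eq_neg, eq_neg_iff_add_eq_zero, add_comm, Set.mem_range]

theorem hasLim_sInf {E : X → Type w} {T : Type w₁} (cls : PSec μ E → T)
    (hcls : Function.Surjective cls) (g : PSec μ fun x => E x → ℝ) (G : T → ℝ)
    (hG : ∀ p, (g.app p).HasLim (G (cls p))) {lo hi : ℝ} (hlo : lo ≤ hi)
    (hg : ∀ x h a, lo ≤ g.val x h a) :
    (g.map fun _ f => sInf (insert hi (Set.range f))).HasLim
      (sInf (insert hi (Set.range G))) := by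
  simp only [sInf_insert_range]
  exact (hasLim_sSup cls hcls (g.map fun _ f a => -f a) (fun a => -G a) (fun p => (hG p).neg)
    (neg_le_neg hlo) fun x h a => neg_le_neg (hg x h a)).neg

end PSec

/-! ### Values of formulas -/

namespace ContLanguage

variable {L : ContLanguage.{v}}

theorem Formula.range_le {Γ : List L.Srt} (φ : L.Formula Γ) : φ.range.1 ≤ φ.range.2 := by
  induction φ with
  | dist => exact (L.bound_pos _).le
  | rel R => exact L.lo_le_hi R
  | conn g φ ih =>
    exact csInf_le_csSup ((Set.nonempty_Icc.2 ih).image g)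
      (isCompact_Icc.image g.continuous).bddBelow (isCompact_Icc.image g.continuous).bddAbove
  | sup s φ ih => exact ih
  | inf s φ ih => exact ih

theorem Formula.val_mem {M : Str.{u} L} {Γ : List L.Srt} (φ : L.Formula Γ) (e : Env M Γ) :
    φ.val e ∈ Set.Icc φ.range.1 φ.range.2 := by
  induction φ with
  | dist t₁ t₂ => exact ⟨dist_nonneg, (M.sort _).bounded _ _⟩
  | rel R t => exact M.rel_mem R _
  | conn g φ ih =>
    have h : g (fun j => (φ j).val e) ∈
        g '' Set.Icc (fun j => (φ j).range.1) (fun j => (φ j).range.2) :=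
      ⟨_, ⟨fun j => (ih j e).1, fun j => (ih j e).2⟩, rfl⟩
    exact ⟨csInf_le (isCompact_Icc.image g.continuous).bddBelow h,
      le_csSup (isCompact_Icc.image g.continuous).bddAbove h⟩
  | sup s φ ih =>
    have hb : φ.range.2 ∈ upperBounds
        (insert φ.range.1 (Set.range fun a : (M.sort s).carrier => φ.val (e.cons a))) := by
      rintro _ (rfl | ⟨a, rfl⟩)
      exacts [φ.range_le, (ih _).2]
    exact ⟨le_csSup ⟨_, hb⟩ (Set.mem_insert _ _), csSup_le (Set.insert_nonempty _ _) hb⟩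
  | inf s φ ih =>
    have hb : φ.range.1 ∈ lowerBounds
        (insert φ.range.2 (Set.range fun a : (M.sort s).carrier => φ.val (e.cons a))) := by
      rintro _ (rfl | ⟨a, rfl⟩)
      exacts [φ.range_le, (ih _).1]
    exact ⟨le_csInf (Set.insert_nonempty _ _) hb, csInf_le ⟨_, hb⟩ (Set.mem_insert _ _)⟩

/-! ### The ultraproduct of metric structures -/

section

variable {X : Type u} {μ : Ultrafilter X} {M : X → Str.{u} L}

theorem abs_sub_le_add_of_close {a b r t ε δ : ℝ} (h : |a - b| ≤ ε) (ha : |a - r| < δ / 2)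
    (hb : |b - t| < δ / 2) : |r - t| ≤ ε + δ := by
  have h := abs_le.1 h
  have ha := abs_lt.1 ha
  have hb := abs_lt.1 hb
  exact abs_le.2 ⟨by linarith [h.1, ha.2, hb.1], by linarith [h.2, ha.1, hb.2]⟩

theorem mem_close_of_dist_lt {k : ℝ} {E : X → CompMet.{u} k}
    {a b : (CompMet.ultraprod μ E).carrier} {δ : ℝ} (h : dist a b < δ) :
    {x | ∃ (h : x ∈ (Quotient.out a).dom) (h' : x ∈ (Quotient.out b).dom),
      dist ((Quotient.out a).val x h) ((Quotient.out b).val x h') < δ} ∈ μ := by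
  rw [← Ultraprod.mk_out a, ← Ultraprod.mk_out b] at h
  exact mem_of_superset ((Ultraprod.hasLim_limDist (Quotient.out a) (Quotient.out b)).mem_of_lt h)
    fun x ⟨h, l⟩ => ⟨h.1, h.2, l⟩

/-- The values of a relation symbol along a tuple of partial sections have a limit. -/
theorem exists_hasLim_rel (M : X → Str.{u} L) (R : L.Rel)
    (p : ∀ j, PSec μ fun x => ((M x).sort (L.relDom R j)).carrier) :
    ∃ r, ((PSec.tuple p).map fun x v => (M x).rel R v).HasLim r :=
  PSec.exists_hasLim _ fun x _ => (M x).rel_mem R _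

/-- The ultraproduct of metric structures: every sort is the metric ultraproduct, function symbols
are interpreted entrywise and relation symbols by the limits of their values. -/
noncomputable def Str.ultraprod (μ : Ultrafilter X) (M : X → Str.{u} L) : Str.{u} L where
  sort s := CompMet.ultraprod μ fun x => (M x).sort s
  fn f a := Ultraprod.mk ((PSec.tuple fun j => Quotient.out (a j)).map fun x v => (M x).fn f v)
  fn_unif f ε hε a b h := by
    refine (Ultraprod.hasLim_limDist _ _).le_const
      (mem_of_superset (PSec.tuple_close fun j => mem_close_of_dist_lt (h j)) ?_)
    rintro x ⟨h₁, h₂, l⟩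
    exact ⟨⟨h₁, h₂⟩, (M x).fn_unif f ε hε _ _ l⟩
  rel R a := (exists_hasLim_rel M R fun j => Quotient.out (a j)).choose
  rel_mem R a := by
    have h := (exists_hasLim_rel M R fun j => Quotient.out (a j)).choose_spec
    have hd := (PSec.tuple fun j => Quotient.out (a j)).dom_mem
    exact ⟨h.const_le (mem_of_superset hd fun x hx => ⟨hx, ((M x).rel_mem R _).1⟩),
      h.le_const (mem_of_superset hd fun x hx => ⟨hx, ((M x).rel_mem R _).2⟩)⟩
  rel_unif R ε hε a b h := by
    refine le_of_forall_pos_le_add fun δ hδ => ?_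
    obtain ⟨x, ⟨h₁, h₂, l⟩, ⟨_, l₁⟩, ⟨_, l₂⟩⟩ := μ.nonempty_of_mem (inter_mem
      (PSec.tuple_close fun j => mem_close_of_dist_lt (h j)) (inter_mem
        ((exists_hasLim_rel M R fun j => Quotient.out (a j)).choose_spec (δ / 2) (half_pos hδ))
        ((exists_hasLim_rel M R fun j => Quotient.out (b j)).choose_spec (δ / 2) (half_pos hδ))))
    exact abs_sub_le_add_of_close ((M x).rel_unif R ε hε _ _ l) l₁ l₂

theorem Str.ultraprod_fn (f : L.Fn)
    (p : ∀ j, PSec μ fun x => ((M x).sort (L.fnDom f j)).carrier) :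
    (Str.ultraprod μ M).fn f (fun j => Ultraprod.mk (p j)) =
      Ultraprod.mk ((PSec.tuple p).map fun x v => (M x).fn f v) := by
  refine Ultraprod.mk_eq.2 fun ε hε => ?_
  refine mem_of_superset (PSec.tuple_close fun j => Ultraprod.mk_eq.1
    (Ultraprod.mk_out (Ultraprod.mk (p j))) _ (L.fnMod_pos f (ε / 2) (half_pos hε))) ?_
  rintro x ⟨h₁, h₂, l⟩
  exact ⟨h₁, h₂, ((M x).fn_unif f _ (half_pos hε) _ _ l).trans_lt (half_lt_self hε)⟩

theorem Str.ultraprod_rel (R : L.Rel)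
    (p : ∀ j, PSec μ fun x => ((M x).sort (L.relDom R j)).carrier) :
    ((PSec.tuple p).map fun x v => (M x).rel R v).HasLim
      ((Str.ultraprod μ M).rel R fun j => Ultraprod.mk (p j)) := by
  intro ε hε
  refine mem_of_superset (inter_mem
    ((exists_hasLim_rel M R fun j => Quotient.out (Ultraprod.mk (p j))).choose_spec
      (ε / 2) (half_pos hε))
    (PSec.tuple_close fun j => Ultraprod.mk_eq.1
      (Ultraprod.mk_out (Ultraprod.mk (p j))) _ (L.relMod_pos R (ε / 2) (half_pos hε)))) ?_
  rintro x ⟨⟨_, l₁⟩, h₁, h₂, l⟩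
  refine ⟨h₂, ?_⟩
  have l₃ := (M x).rel_unif R _ (half_pos hε) _ _ l
  rw [abs_sub_comm] at l₃
  refine (abs_sub_le _ _ _).trans_lt ((add_lt_add_of_le_of_lt l₃ l₁).trans_eq (add_halves ε))

/-! ### Łoś's theorem for continuous logic -/

/-- The assignment in the ultraproduct given by a partial section of assignments. -/
def Env.ofSec {Γ : List L.Srt} (e : PSec μ fun x => Env (M x) Γ) : Env (Str.ultraprod μ M) Γ :=
  fun s v => Ultraprod.mk (e.map fun _ w => w s v)

/-- The extension of a partial section of assignments. -/
def Env.consSec {Γ : List L.Srt} {t : L.Srt} (p : PSec μ fun x => ((M x).sort t).carrier)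
    (e : PSec μ fun x => Env (M x) Γ) : PSec μ fun x => Env (M x) (t :: Γ) where
  dom := e.dom ∩ p.dom
  dom_mem := inter_mem e.dom_mem p.dom_mem
  val x h := (e.val x h.1).cons (p.val x h.2)

theorem Env.cons_ofSec {Γ : List L.Srt} {t : L.Srt}
    (p : PSec μ fun x => ((M x).sort t).carrier) (e : PSec μ fun x => Env (M x) Γ) :
    Env.cons (M := Str.ultraprod μ M) (Ultraprod.mk p) (ofSec e) = ofSec (consSec p e) := by
  funext s v
  cases v with
  | zero => exact Ultraprod.mk_eq_of_agree (mem_of_superset (consSec p e).dom_mem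
      fun x h => ⟨h.2, h, rfl⟩)
  | succ v => exact Ultraprod.mk_eq_of_agree (mem_of_superset (consSec p e).dom_mem
      fun x h => ⟨h.1, h, rfl⟩)

theorem Env.ofSec_surjective {Γ : List L.Srt} :
    Function.Surjective (ofSec : (PSec μ fun x => Env (M x) Γ) → _) := by
  induction Γ with
  | nil => exact fun e => ⟨⟨Set.univ, univ_mem, fun x _ => Env.nil (M x)⟩,
      funext fun s => funext fun v => nomatch v⟩
  | cons t Γ ih =>
    intro e
    obtain ⟨e', he⟩ := ih fun s v => e s (.succ v)
    obtain ⟨p, hp⟩ := Ultraprod.mk_surj (e t .zero)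
    refine ⟨consSec p e', ?_⟩
    rw [← cons_ofSec, he, hp]
    funext s v
    cases v <;> rfl

theorem Term.val_ofSec {Γ : List L.Srt} {s : L.Srt} (t : L.Term Γ s)
    (e : PSec μ fun x => Env (M x) Γ) :
    t.val (Env.ofSec e) = Ultraprod.mk (e.map fun _ w => t.val w) := by
  induction t with
  | var v => rfl
  | app f t ih =>
    refine (congrArg ((Str.ultraprod μ M).fn f) (funext fun j => ih j)).trans ?_
    refine (Str.ultraprod_fn f _).trans (Ultraprod.mk_eq_of_agree ?_)
    exact mem_of_superset e.dom_mem fun x h => ⟨fun _ => h, h, rfl⟩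

/-- The value of a formula in an ultraproduct is the limit of its values. -/
theorem Formula.hasLim_val {Γ : List L.Srt} (φ : L.Formula Γ)
    (e : PSec μ fun x => Env (M x) Γ) :
    (e.map fun _ w => φ.val w).HasLim (φ.val (Env.ofSec e)) := by
  induction φ with
  | dist t₁ t₂ =>
    simp only [Formula.val, Term.val_ofSec]
    exact (Ultraprod.hasLim_limDist _ _).congr
      (mem_of_superset e.dom_mem fun x h => ⟨⟨h, h⟩, h, rfl⟩)
  | rel R t =>
    simp only [Formula.val, Term.val_ofSec]
    exact (Str.ultraprod_rel R _).congr
      (mem_of_superset e.dom_mem fun x h => ⟨fun _ => h, h, rfl⟩)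
  | conn g φ ih =>
    exact (PSec.HasLim.continuous_comp g fun j => ih j e).congr
      (mem_of_superset e.dom_mem fun x h => ⟨fun _ => h, h, rfl⟩)
  | sup s φ ih =>
    have H : ∀ p : PSec μ fun x => ((M x).sort s).carrier,
        (PSec.app (E := fun x => ((M x).sort s).carrier)
          (e.map fun x w a => φ.val (w.cons a)) p).HasLim
        (φ.val (Env.cons (M := Str.ultraprod μ M) (Ultraprod.mk p) (Env.ofSec e))) := fun p => by
      rw [Env.cons_ofSec]
      exact ih (Env.consSec p e)
    exact PSec.hasLim_sSup Ultraprod.mk Ultraprod.mk_surj _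
      (fun a => φ.val (Env.cons (M := Str.ultraprod μ M) a (Env.ofSec e))) H φ.range_le
      fun x h a => (φ.val_mem _).2
  | inf s φ ih =>
    have H : ∀ p : PSec μ fun x => ((M x).sort s).carrier,
        (PSec.app (E := fun x => ((M x).sort s).carrier)
          (e.map fun x w a => φ.val (w.cons a)) p).HasLim
        (φ.val (Env.cons (M := Str.ultraprod μ M) (Ultraprod.mk p) (Env.ofSec e))) := fun p => by
      rw [Env.cons_ofSec]
      exact ih (Env.consSec p e)
    exact PSec.hasLim_sInf Ultraprod.mk Ultraprod.mk_surj _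
      (fun a => φ.val (Env.cons (M := Str.ultraprod μ M) a (Env.ofSec e))) H φ.range_le
      fun x h a => (φ.val_mem _).1

end

/-! ### Models -/

variable {Th : Set L.Sentence}

theorem ElemMap.ext {M N : Model.{u} Th} {f g : ElemMap M N}
    (h : f.toFun = g.toFun) : f = g := by
  cases f
  cases g
  cases h
  rfl

namespace Model

theorem hom_ext {M N : Model.{u} Th} {f g : M ⟶ N}
    (h : ∀ s, (sortFunctor Th s).map f = (sortFunctor Th s).map g) : f = g :=
  ElemMap.ext (funext fun s => congrArg Subtype.val (h s))

theorem isIso_of_bijective {M N : Model.{u} Th} (f : M ⟶ N)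
    (hf : ∀ s, Function.Bijective (CompMet.fn ((sortFunctor Th s).map f))) : IsIso f := by
  choose g hg hg' using fun s => Function.bijective_iff_has_inverse.1 (hf s)
  refine ⟨⟨g, fun φ e => ?_⟩, hom_ext fun s => CompMet.hom_ext (hg s),
    hom_ext fun s => CompMet.hom_ext (hg' s)⟩
  exact (ElemMap.elem f φ _).symm.trans
    (congrArg φ.val (funext fun s => funext fun v => hg' s (e s v)))

/-- The ultraproduct of models. -/
noncomputable def ultraprod (x : Ult.{u} (Model.{u} Th)) : Model.{u} Th where
  str := Str.ultraprod x.uf fun i => (x.obj i).str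
  sat φ hφ := by
    have h := φ.hasLim_val (μ := x.uf) (M := fun i => (x.obj i).str)
      ⟨Set.univ, univ_mem, fun i _ => Env.nil (x.obj i).str⟩
    have e : Env.ofSec (μ := x.uf) (M := fun i => (x.obj i).str)
        ⟨Set.univ, univ_mem, fun i _ => Env.nil (x.obj i).str⟩ = Env.nil _ :=
      funext fun s => funext fun v => nomatch v
    rw [e] at h
    refine h.unique fun ε hε => mem_of_superset univ_mem fun i _ => ⟨trivial, ?_⟩
    simpa [PSec.map, (x.obj i).sat φ hφ] using hε

/-- The map of ultraproducts of models induced by a morphism of formal ultraproducts. It is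
elementary, as the values of a formula in both ultraproducts are limits of the same values. -/
noncomputable def ultraprodMap {x y : Ult.{u} (Model.{u} Th)} (f : x ⟶ y) :
    ultraprod x ⟶ ultraprod y where
  toFun s := Ultraprod.pushHom (sortFunctor Th s) f
  elem {Γ} φ e := by
    obtain ⟨e, rfl⟩ := Env.ofSec_surjective e
    obtain ⟨ψ, rfl⟩ := Ult.homMk_surj f
    let e' : PSec y.uf fun j => Env (y.obj j).str Γ :=
      ⟨{j | ∃ h : j ∈ ψ.sec.dom, (ψ.sec.val j h).1 ∈ e.dom}, (ψ.push _).1 e.dom_mem,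
        fun j h s v => ElemMap.toFun (ψ.sec.val j h.1).2 s (e.val _ h.2 s v)⟩
    have he : (fun s v => Ultraprod.pushHom (sortFunctor Th s) (Ult.homMk ψ) (Env.ofSec e s v)) =
        Env.ofSec e' :=
      funext fun s => funext fun v => Ultraprod.pushHom_mk (sortFunctor Th s) ψ _
    refine (congrArg φ.val he).trans ((φ.hasLim_val e').unique fun ε hε => ?_)
    refine mem_of_superset ((ψ.push _).1 (φ.hasLim_val e ε hε)) ?_
    rintro j ⟨h₁, h₂, l⟩
    refine ⟨⟨h₁, h₂⟩, ?_⟩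
    have := ElemMap.elem (ψ.sec.val j h₁).2 φ (e.val _ h₂)
    exact (congrArg (fun t => |t - φ.val (Env.ofSec e)|) this).trans_lt l

/-- The ultraproduct of models as a functor. -/
noncomputable def action (Th : Set L.Sentence) : Ult.{u} (Model.{u} Th) ⥤ Model.{u} Th where
  obj := ultraprod
  map := ultraprodMap
  map_id _ := hom_ext fun s => CompMet.hom_ext (Ultraprod.pushHom_id (sortFunctor Th s))
  map_comp f g := hom_ext fun s => CompMet.hom_ext (Ultraprod.pushHom_comp (sortFunctor Th s) f g)

/-- In every sort, the points of `action Th` are the points of the metric ultraproduct. -/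
noncomputable def actionData (Th : Set L.Sentence) (s : L.Srt) :
    ActionData (action.{u} Th) (sortFunctor.{u} Th s) where
  pt _ := Equiv.refl _
  dist_lim _ p q := Ultraprod.hasLim_limDist p q
  map_pt φ p := Ultraprod.pushHom_mk (sortFunctor Th s) φ p

/-- The standard unitor. -/
noncomputable def unitorHom (c : Model.{u} Th) : (action.{u} Th).obj (Ult.unit.obj c) ⟶ c where
  toFun s := (actionData.{u} Th s).entry c
  elem {Γ} φ e := by
    obtain ⟨e, rfl⟩ := Env.ofSec_surjective e
    have h : PUnit.unit ∈ e.dom := ActionData.star_mem_dom e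
    have he : (fun s v => (actionData.{u} Th s).entry c (Env.ofSec e s v)) =
        e.val PUnit.unit h :=
      funext fun s => funext fun v => (actionData.{u} Th s).entry_pt c
        (PSec.map (fun _ (w : Env c.str Γ) => w s v) e) h
    refine (congrArg φ.val he).trans (PSec.HasLim.unique (fun ε hε => ?_) (φ.hasLim_val e))
    exact Filter.mem_pure.2 ⟨h, (abs_eq_zero.2 (sub_self (φ.val (e.val PUnit.unit h)))).trans_lt hε⟩

/-- The standard associator. It is elementary, as the limit over a disjoint union is the iterated
limit. -/
noncomputable def associatorHom (x : Ult.{u} (Ult.{u} (Model.{u} Th))) :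
    (action.{u} Th).obj (Ult.mult.obj x) ⟶
      (action.{u} Th).obj ((Ult.map (action.{u} Th)).obj x) where
  toFun s := (actionData.{u} Th s).comparison x
  elem {Γ} φ e := by
    obtain ⟨e, rfl⟩ := Env.ofSec_surjective (μ := (Ult.mult.obj x).uf)
      (M := fun i => ((Ult.mult.obj x).obj i).str) e
    let E : Model.{u} Th → Type (max u v) := fun c => Env c.str Γ
    let e' : PSec x.uf fun s => Env (ultraprod (x.obj s)).str Γ :=
      (PSec.curry (E := E) e).map fun s r =>
        Env.ofSec (μ := (x.obj s).uf) (M := fun i => ((x.obj s).obj i).str) r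
    have he : (fun s v => (actionData.{u} Th s).comparison x (Env.ofSec e s v)) =
        Env.ofSec (μ := x.uf) (M := fun s => (ultraprod (x.obj s)).str) e' :=
      funext fun s => funext fun v =>
        (actionData.{u} Th s).comparison_pt x
          (PSec.map (fun i (w : Env ((Ult.mult.obj x).obj i).str Γ) => w s v) e)
    refine (congrArg φ.val he).trans ((φ.hasLim_val (μ := x.uf)
      (M := fun s => (ultraprod (x.obj s)).str) e').unique ?_)
    exact (φ.hasLim_val (μ := (Ult.mult.obj x).uf)
      (M := fun i => ((Ult.mult.obj x).obj i).str) e).curry (x := x) fun s h _ =>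
      φ.hasLim_val (μ := (x.obj s).uf) (M := fun i => ((x.obj s).obj i).str)
        ((PSec.curry (E := E) e).val s h)

/-- The ultraproduct algebra of models of a theory. -/
noncomputable def algebra (Th : Set L.Sentence) : ColaxAlgebra.{u} (Model.{u} Th) where
  m := action.{u} Th
  i :=
    { app := unitorHom
      naturality _ _ g := hom_ext fun s =>
        (actionData.{u} Th s).unitor_naturality (i := unitorHom) (fun _ _ => rfl) g }
  a :=
    { app := associatorHom
      naturality _ _ f := hom_ext fun s =>
        (actionData.{u} Th s).associator_naturality (a := associatorHom) (fun _ _ => rfl) f }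
  left_unit x := hom_ext fun s => (actionData.{u} Th s).left_unit (i := unitorHom)
    (a := associatorHom) (fun _ _ => rfl) (fun _ _ => rfl) x
  right_unit x := hom_ext fun s => (actionData.{u} Th s).right_unit (a := associatorHom)
    (fun _ _ => rfl) (fun _ _ => rfl) x
  assoc x := hom_ext fun s => (actionData.{u} Th s).assoc (fun _ _ => rfl) x

theorem algebra_isUltraproductAlgebra (Th : Set L.Sentence) :
    IsUltraproductAlgebra (algebra.{u} Th) :=
  ⟨fun s =>
    { pt := (actionData.{u} Th s).pt
      dist_lim := (actionData.{u} Th s).dist_lim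
      map_pt := (actionData.{u} Th s).map_pt
      unit_pt := (actionData.{u} Th s).entry_pt
      assoc_pt := (actionData.{u} Th s).comparison_pt },
    fun _ f p => Str.ultraprod_fn f p, fun _ R p => Str.ultraprod_rel R p⟩

theorem IsUltraproductAlgebra.isPseudoAlgebra {P : ColaxAlgebra.{u} (Model.{u} Th)}
    (h : IsUltraproductAlgebra P) : P.IsPseudoAlgebra := by
  obtain ⟨D, _⟩ := h
  exact ColaxAlgebra.isPseudoAlgebra_of_isIso
    (fun c => isIso_of_bijective _ fun s => (D s).unitor_bijective c)
    (fun x => isIso_of_bijective _ fun s => (D s).associator_bijective x)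

end Model

end ContLanguage

theorem mainTheorem6 :
    (∀ (L : ContLanguage.{v}) (Th : Set L.Sentence),
      (∃ P : ColaxAlgebra.{u} (ContLanguage.Model.{u} Th),
        ContLanguage.Model.IsUltraproductAlgebra P ∧ P.IsPseudoAlgebra) ∧
      ∀ P : ColaxAlgebra.{u} (ContLanguage.Model.{u} Th),
        ContLanguage.Model.IsUltraproductAlgebra P → P.IsPseudoAlgebra) ∧
    ∀ k : ℝ,
      (∃ P : ColaxAlgebra.{u} (CompMet.{u} k),
        CompMet.IsUltraproductAlgebra P ∧ P.IsPseudoAlgebra) ∧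
      ∀ P : ColaxAlgebra.{u} (CompMet.{u} k), CompMet.IsUltraproductAlgebra P →
        P.IsPseudoAlgebra ∧
          ∀ x : Ult.{u} (Ult.{u} (CompMet.{u} k)), Function.Bijective (CompMet.fn (P.a.app x)) := by
  refine ⟨fun L Th => ⟨⟨ContLanguage.Model.algebra Th,
      ContLanguage.Model.algebra_isUltraproductAlgebra Th,
      (ContLanguage.Model.algebra_isUltraproductAlgebra Th).isPseudoAlgebra⟩,
    fun P h => h.isPseudoAlgebra⟩, fun k => ⟨⟨CompMet.algebra k,
      CompMet.algebra_isUltraproductAlgebra k,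
      (CompMet.algebra_isUltraproductAlgebra k).isPseudoAlgebra⟩,
    fun P h => ⟨h.isPseudoAlgebra, fun x => ?_⟩⟩⟩
  obtain ⟨D⟩ := h
  exact D.associator_bijective x
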